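/- **Setting.** Let $\mathcal X$ be a finite set and $Q:\mathcal X\times\mathcal X\to[0,\infty)$ with $Q(x,x)=0$ for all $x$. Assume that $Q$ is irreducible (for all $x,y$ there are $n\ge 0$ and $x=x_0,\dots,x_n=y$ with $Q(x_{i-1},x_i)>0$ for $1\le i\le n$) and reversible with respect to a probability measure $\pi$ on $\mathcal X$, i.e. $\pi(x)Q(x,y)=\pi(y)Q(y,x)$ for all $x,y$. Let $\Lambda:[0,\infty)^2\to[0,\infty)$ be an admissible mean: continuous, $C^\infty$ on $(0,\infty)^2$, symmetric, positively $1$-homogeneous, non-decreasing in each variable, jointly concave, with $\Lambda(1,1)=1$. Let $\mathcal P(\mathcal X)$ be the set of probability measures on $\mathcal X$, regarded as vectors in $\mathbb R^{\mathcal X}$, and $\langle\phi,\psi\rangle=\sum_x\phi(x)\psi(x)$. **Transport distance.** For $s,t\geq 0$ and $w\in\mathbb R$ let $A(s,t,w)=w^2/\Lambda(s,t)$ if $s,t>0$, $A(s,t,w)=0$ if $w=0$, and $A(s,t,w)=+\infty$ otherwise. For $\mu\in\mathcal P(\mathcal X)$ and $V\in\mathbb R^{\mathcal X\times\mathcal X}$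 put $$\mathcal A(\mu,V)=\tfrac12\sum_{x,y}A\big(\mu(x)Q(x,y),\mu(y)Q(y,x),V(x,y)\big).$$ For $\mu_0,\mu_1\in\mathcal P(\mathcal X)$ let $\mathsf{CE}_1(\mu_0,\mu_1)$ be the set of pairs $(\mu_t,V_t)_{t\in[0,1]}$ such that $\mu:[0,1]\to\mathcal P(\mathcal X)$ is continuous with the given values $\mu_0,\mu_1$ at $t=0,1$, $V:[0,1]\to\mathbb R^{\mathcal X\times\mathcal X}$ is integrable, and $\frac{d}{dt}\mu_t(x)+\frac12\sum_y(V_t(x,y)-V_t(y,x))=0$ in the sense of distributions on $(0,1)$ for every $x\in\mathcal X$. Define $$\mathcal W(\mu_0,\mu_1)=\inf\Big\{\Big(\int_0^1\mathcal A(\mu_t,V_t)\,dt\Big)^{1/2}:(\mu,V)\in\mathsf{CE}_1(\mu_0,\mu_1)\Big\}.$$ **Hamilton–Jacobi subsolutions.** Let $\mathsf{HJ}^1_{\mathcal X}$ be the set of all $\phi\in H^1((0,1);\mathbb R^{\mathcal X})$ (identified with their continuous representatives on $[0,1]$) such that for a.e. $t\in(0,1)$ $$\langle\dot\phi_t,\mu\rangle+\tfrac14\sum_{x,y}\big(\phi_t(y)-\phi_t(x)\big)^2\,\Lambda\big(\mu(x)Q(x,y),\mu(y)Q(y,x)\big)\le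 0\qquad\text{for all }\mu\in\mathcal P(\mathcal X).$$ **Theorem (duality formula).** For all $\mu_0,\mu_1\in\mathcal P(\mathcal X)$, $\mathcal W(\mu_0,\mu_1)$ is finite and $$\tfrac12\,\mathcal W(\mu_0,\mu_1)^2=\sup\big\{\langle\phi_1,\mu_1\rangle-\langle\phi_0,\mu_0\rangle:\ \phi\in\mathsf{HJ}^1_{\mathcal X}\big\}.$$ The formula remains true if the supremum is restricted to those $\phi\in\mathsf{HJ}^1_{\mathcal X}$ that belong to $C^1([0,1];\mathbb R^{\mathcal X})$. -/

import Mathlib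

open MeasureTheory Set
open scoped ENNReal ContDiff

noncomputable section

namespace DiscreteTransport

/-- `IsMarkovTriple Q π`: the rates `Q ≥ 0` on the finite set `X` (with vanishing diagonal) are
irreducible, and reversible with respect to the probability measure `π`. Reversibility makes `π`
stationary, and by irreducibility it is the only stationary probability measure. -/
structure IsMarkovTriple {X : Type*} [Fintype X] (Q : X → X → ℝ) (π : X → ℝ) : Prop where
  rate_nonneg : ∀ x y, 0 ≤ Q x y
  rate_self : ∀ x, Q x x = 0
  irreducible : ∀ x y, Relation.ReflTransGen (fun a b => 0 < Q a b) x y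
  prob : π ∈ stdSimplex ℝ X
  detailed_balance : ∀ x y, π x * Q x y = π y * Q y x

/-- Admissible means `[0,∞) × [0,∞) → [0,∞)`. Only the values of `Λ` on nonnegative arguments
matter. -/
structure IsAdmissibleMean (Λ : ℝ → ℝ → ℝ) : Prop where
  nonneg : ∀ s t, 0 ≤ s → 0 ≤ t → 0 ≤ Λ s t
  continuousOn : ContinuousOn (fun p : ℝ × ℝ => Λ p.1 p.2) (Ici 0 ×ˢ Ici 0)
  smooth : ContDiffOn ℝ ∞ (fun p : ℝ × ℝ => Λ p.1 p.2) (Ioi 0 ×ˢ Ioi 0)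
  symm : ∀ s t, 0 ≤ s → 0 ≤ t → Λ s t = Λ t s
  homogeneous : ∀ c s t, 0 < c → 0 ≤ s → 0 ≤ t → Λ (c * s) (c * t) = c * Λ s t
  mono : ∀ s s' t t', 0 ≤ s → s ≤ s' → 0 ≤ t → t ≤ t' → Λ s t ≤ Λ s' t'
  concave : ConcaveOn ℝ (Ici 0 ×ˢ Ici 0) (fun p : ℝ × ℝ => Λ p.1 p.2)
  normalised : Λ 1 1 = 1

/-- `v` is the distributional derivative of `u` on the open interval `(0,T)`. It is used only for
`u` and `v` integrable on `(0,T)`. -/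
def HasWeakDeriv (T : ℝ) (u v : ℝ → ℝ) : Prop :=
  ∀ η : ℝ → ℝ, ContDiff ℝ ∞ η → HasCompactSupport η → tsupport η ⊆ Ioo 0 T →
    ∫ t in Ioo 0 T, u t * deriv η t = - ∫ t in Ioo 0 T, v t * η t

section

variable {X : Type*} [Fintype X]

/-- The Euclidean inner product `⟨φ, ψ⟩ = ∑ x, φ(x) ψ(x)`. -/
def ip (φ ψ : X → ℝ) : ℝ := ∑ x, φ x * ψ x

/-- The discrete gradient `∇φ(x,y) = φ(y) - φ(x)`. -/
def grad (φ : X → ℝ) (x y : X) : ℝ := φ y - φ x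

/-- The discrete divergence `(∇·V)(x) = ½ ∑ y, (V(x,y) - V(y,x))`. -/
def divergence (V : X → X → ℝ) (x : X) : ℝ := (1 / 2) * ∑ y, (V x y - V y x)

/-- The weight `μ̂(x,y) = Λ(μ(x)Q(x,y), μ(y)Q(y,x))`. -/
def edgeWeight (Λ : ℝ → ℝ → ℝ) (Q : X → X → ℝ) (μ : X → ℝ) (x y : X) : ℝ :=
  Λ (μ x * Q x y) (μ y * Q y x)

/-- The squared norm `‖Φ‖²_μ = ½ ∑ x y, Φ(x,y)² μ̂(x,y)`. -/
def normSq (Λ : ℝ → ℝ → ℝ) (Q : X → X → ℝ) (μ : X → ℝ) (Φ : X → X → ℝ) : ℝ :=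
  (1 / 2) * ∑ x, ∑ y, Φ x y ^ 2 * edgeWeight Λ Q μ x y

open Classical in
/-- The action density `A(s,t,w)`: it is `w²/Λ(s,t)` if `s,t > 0`, it is `0` if `w = 0` and
`s,t ≥ 0`, and it is `+∞` otherwise. -/
def actionDensity (Λ : ℝ → ℝ → ℝ) (s t w : ℝ) : ℝ≥0∞ :=
  if 0 < s ∧ 0 < t then ENNReal.ofReal (w ^ 2 / Λ s t)
  else if w = 0 ∧ 0 ≤ s ∧ 0 ≤ t then 0
  else ⊤

/-- The action `𝒜(μ,V) = ½ ∑ x y, A(μ(x)Q(x,y), μ(y)Q(y,x), V(x,y))`. -/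
def action (Λ : ℝ → ℝ → ℝ) (Q : X → X → ℝ) (μ : X → ℝ) (V : X → X → ℝ) : ℝ≥0∞ :=
  (1 / 2) * ∑ x, ∑ y, actionDensity Λ (μ x * Q x y) (μ y * Q y x) (V x y)

/-- `(μ,V)` solves the continuity equation `∂ₜμ + ∇·V = 0` on `[0,T]` and joins `μ₀` to `μ₁`.
Curves are functions on `ℝ` of which only the restriction to `[0,T]` matters; `𝒫(X)` is the
standard simplex. -/
structure IsCE (T : ℝ) (μ₀ μ₁ : X → ℝ) (μ : ℝ → X → ℝ) (V : ℝ → X → X → ℝ) : Prop where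
  continuousOn : ContinuousOn μ (Icc 0 T)
  locallyIntegrableOn : LocallyIntegrableOn V (Icc 0 T)
  prob : ∀ t ∈ Icc 0 T, μ t ∈ stdSimplex ℝ X
  continuity_equation : ∀ x, HasWeakDeriv T (fun t => μ t x) (fun t => - divergence (V t) x)
  initial : μ 0 = μ₀
  terminal : μ T = μ₁

/-- The discrete transport distance
`𝒲(μ₀,μ₁) = inf { (∫₀¹ 𝒜(μ_t,V_t) dt)^{1/2} : (μ,V) ∈ CE₁(μ₀,μ₁) }`, with values in `[0,∞]`. -/
def transportDist (Λ : ℝ → ℝ → ℝ) (Q : X → X → ℝ) (μ₀ μ₁ : X → ℝ) : ℝ≥0∞ :=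
  ⨅ (μ : ℝ → X → ℝ) (V : ℝ → X → X → ℝ) (_ : IsCE 1 μ₀ μ₁ μ V),
    (∫⁻ t in Icc (0 : ℝ) 1, action Λ Q (μ t) (V t)) ^ (1 / 2 : ℝ)

/-- `φ ∈ H¹((0,T); ℝ^X)` with weak derivative `φ'`, where `φ` is the representative that is
continuous on `[0,T]`, so that `φ 0` and `φ T` are the boundary values of the Sobolev function. -/
structure IsH1 (T : ℝ) (φ φ' : ℝ → X → ℝ) : Prop where
  continuousOn : ContinuousOn φ (Icc 0 T)
  memLp : MemLp φ 2 (volume.restrict (Ioo 0 T))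
  memLp_deriv : MemLp φ' 2 (volume.restrict (Ioo 0 T))
  weakDeriv : ∀ x, HasWeakDeriv T (fun t => φ t x) (fun t => φ' t x)

/-- The set `HJ^T` of Hamilton--Jacobi subsolutions: `φ ∈ H¹((0,T); ℝ^X)` such that for a.e.
`t ∈ (0,T)`, `⟨φ̇_t, μ⟩ + ½ ‖∇φ_t‖²_μ ≤ 0` for all `μ ∈ 𝒫(X)`. -/
def HJ (Λ : ℝ → ℝ → ℝ) (Q : X → X → ℝ) (T : ℝ) : Set (ℝ → X → ℝ) :=
  {φ | ∃ φ' : ℝ → X → ℝ, IsH1 T φ φ' ∧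
    ∀ᵐ t ∂(volume.restrict (Ioo 0 T)), ∀ μ ∈ stdSimplex ℝ X,
      ip (φ' t) μ + (1 / 2) * normSq Λ Q μ (grad (φ t)) ≤ 0}

/-- The Hamilton--Jacobi subsolutions that belong to `C¹([0,T]; ℝ^X)`. -/
def HJC1 (Λ : ℝ → ℝ → ℝ) (Q : X → X → ℝ) (T : ℝ) : Set (ℝ → X → ℝ) :=
  {φ | φ ∈ HJ Λ Q T ∧ ContDiffOn ℝ 1 φ (Icc 0 T)}

end

end DiscreteTransport

end

noncomputable section

namespace DiscreteTransport

/-! ### Elementary properties of admissible means. -/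

namespace IsAdmissibleMean

variable {Λ : ℝ → ℝ → ℝ}

/-! Weak duality pairs a subsolution φ with a solution (μ, V) of the continuity equation. The
product rule turns ⟨φ₁,μ₁⟩ - ⟨φ₀,μ₀⟩ into the time integral of ⟨φ̇,μ⟩ + ½ ∑ ∇φ V, and the
Fenchel–Young inequality for w²/Λ together with the Hamilton–Jacobi inequality bounds the integrand
by half the action (`HJ_value_le_action`).

For the converse, let D bound the values of all C¹ subsolutions. The Lagrangian L(g,φ) = ⟨φ₁,μ₁⟩ -
⟨φ₀,μ₀⟩ - ∫ (⟨φ̇,g⟩ + ½‖∇φ‖²_g) is convex in g, because Λ is concave, and concave in φ. For fixed φ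
its infimum over curves g in the simplex replaces the Hamiltonian by its maximum over the simplex;
subtracting the primitive of this maximum from φ gives a C¹ subsolution with exactly that value, so
the infimum is at most D. Curves in the simplex form a bounded closed convex subset of L², and a
minimax principle (`exists_forall_le_of_forall_exists_le`) yields one g with L(g,φ) ≤ D for all C¹
curves φ at once.

For this g, L(g,·) is a linear functional minus half a squared Hilbert norm. Being bounded above by
D, the functional is represented by some Ψ in L² with ‖Ψ‖² ≤ 2D. The representation is the weak
continuity equation, end values included, with flux V = √(2ĝ) Ψ (`exists_isCE_of_lagrangian_le`).

One gap remains: A is +∞ for a nonzero flux as soon as one end of the edge carries no mass, whereas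
Λ may be positive there, so V can have infinite action. Mixing the curve with π by a small amount
that vanishes at times 0 and 1 makes it positive in between. Irreducibility supplies a flux for this
correction, and its cost tends to 0 with the amount (`transportDist_sq_le_of_isCE`). The same device
proves finiteness. Hence ½𝒲² ≤ D, and together with weak duality this settles both suprema. -/

lemma map_zero_zero (hΛ : IsAdmissibleMean Λ) : Λ 0 0 = 0 := by
  have := hΛ.homogeneous 2 0 0 two_pos le_rfl le_rfl
  simp only [mul_zero] at this
  linarith

lemma map_self (hΛ : IsAdmissibleMean Λ) {s : ℝ} (hs : 0 < s) : Λ s s = s := by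
  have := hΛ.homogeneous s 1 1 hs zero_le_one zero_le_one
  simpa [hΛ.normalised] using this

lemma pos (hΛ : IsAdmissibleMean Λ) {s t : ℝ} (hs : 0 < s) (ht : 0 < t) : 0 < Λ s t := by
  have hm : 0 < min s t := lt_min hs ht
  have := hΛ.mono (min s t) s (min s t) t hm.le (min_le_left _ _) hm.le (min_le_right _ _)
  rw [hΛ.map_self hm] at this
  linarith

lemma homogeneous' (hΛ : IsAdmissibleMean Λ) {c s t : ℝ} (hc : 0 ≤ c) (hs : 0 ≤ s) (ht : 0 ≤ t) :
    Λ (c * s) (c * t) = c * Λ s t := by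
  rcases hc.eq_or_lt with rfl | hc
  · simp [hΛ.map_zero_zero]
  · exact hΛ.homogeneous c s t hc hs ht

/-- Concavity at the midpoint, followed by homogeneity with factor ½. Superadditivity needs no
normalised weights, which suits mixtures a • μ + b • ν. -/
lemma add_le (hΛ : IsAdmissibleMean Λ) {s t s' t' : ℝ} (hs : 0 ≤ s) (ht : 0 ≤ t)
    (hs' : 0 ≤ s') (ht' : 0 ≤ t') : Λ s t + Λ s' t' ≤ Λ (s + s') (t + t') := by
  have h := hΛ.concave.2 (mk_mem_prod hs ht) (mk_mem_prod hs' ht')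
    (show (0 : ℝ) ≤ 1 / 2 by norm_num) (show (0 : ℝ) ≤ 1 / 2 by norm_num) (by norm_num)
  have h2 := hΛ.homogeneous (1 / 2) (s + s') (t + t') (by norm_num) (by positivity) (by positivity)
  simp only [Prod.smul_mk, Prod.mk_add_mk, smul_eq_mul, ← mul_add] at h
  rw [h2] at h
  linarith

end IsAdmissibleMean

/-! ### Continuous extension of the mean to the plane. -/

/-- The extension of a mean from the closed quadrant to the plane by projection. -/
def clip (Λ : ℝ → ℝ → ℝ) (s t : ℝ) : ℝ := Λ (max s 0) (max t 0)

lemma clip_eq (Λ : ℝ → ℝ → ℝ) {s t : ℝ} (hs : 0 ≤ s) (ht : 0 ≤ t) : clip Λ s t = Λ s t := by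
  simp [clip, hs, ht]

lemma continuous_clip {Λ : ℝ → ℝ → ℝ} (hΛ : IsAdmissibleMean Λ) :
    Continuous fun p : ℝ × ℝ => clip Λ p.1 p.2 := by
  have h : Continuous fun p : ℝ × ℝ => ((max p.1 0, max p.2 0) : ℝ × ℝ) := by fun_prop
  exact hΛ.continuousOn.comp_continuous h fun p =>
    mk_mem_prod (le_max_right p.1 0) (le_max_right p.2 0)

lemma isAdmissibleMean_clip {Λ : ℝ → ℝ → ℝ} (hΛ : IsAdmissibleMean Λ) :
    IsAdmissibleMean (clip Λ) where
  nonneg s t hs ht := by rw [clip_eq Λ hs ht]; exact hΛ.nonneg s t hs ht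
  continuousOn := (continuous_clip hΛ).continuousOn
  smooth := hΛ.smooth.congr fun p hp => clip_eq Λ (le_of_lt hp.1) (le_of_lt hp.2)
  symm s t hs ht := by rw [clip_eq Λ hs ht, clip_eq Λ ht hs]; exact hΛ.symm s t hs ht
  homogeneous c s t hc hs ht := by
    rw [clip_eq Λ hs ht, clip_eq Λ (by positivity) (by positivity)]
    exact hΛ.homogeneous c s t hc hs ht
  mono s s' t t' hs hss ht htt := by
    rw [clip_eq Λ hs ht, clip_eq Λ (hs.trans hss) (ht.trans htt)]
    exact hΛ.mono s s' t t' hs hss ht htt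
  concave := hΛ.concave.congr fun p hp => (clip_eq Λ hp.1 hp.2).symm
  normalised := by rw [clip_eq Λ zero_le_one zero_le_one]; exact hΛ.normalised

lemma actionDensity_clip (Λ : ℝ → ℝ → ℝ) : actionDensity (clip Λ) = actionDensity Λ := by
  funext s t w
  unfold actionDensity
  split_ifs with h
  · rw [clip_eq Λ h.1.le h.2.le]
  all_goals rfl

section

variable {X : Type*}

lemma edgeWeight_clip (Λ : ℝ → ℝ → ℝ) {Q : X → X → ℝ} (hQ : ∀ x y, 0 ≤ Q x y) {μ : X → ℝ}
    (hμ : ∀ x, 0 ≤ μ x) (x y : X) : edgeWeight (clip Λ) Q μ x y = edgeWeight Λ Q μ x y :=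
  clip_eq Λ (mul_nonneg (hμ x) (hQ x y)) (mul_nonneg (hμ y) (hQ y x))

lemma continuous_edgeWeight {Λ : ℝ → ℝ → ℝ} (hc : Continuous fun p : ℝ × ℝ => Λ p.1 p.2)
    (Q : X → X → ℝ) (x y : X) : Continuous fun μ : X → ℝ => edgeWeight Λ Q μ x y := by
  unfold edgeWeight
  exact hc.comp (f := fun μ : X → ℝ => (μ x * Q x y, μ y * Q y x)) (by fun_prop)

lemma edgeWeight_nonneg {Λ : ℝ → ℝ → ℝ} (hΛ : IsAdmissibleMean Λ) {Q : X → X → ℝ}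
    (hQ : ∀ x y, 0 ≤ Q x y) {μ : X → ℝ} (hμ : ∀ x, 0 ≤ μ x) (x y : X) :
    0 ≤ edgeWeight Λ Q μ x y :=
  hΛ.nonneg _ _ (mul_nonneg (hμ x) (hQ x y)) (mul_nonneg (hμ y) (hQ y x))

lemma edgeWeight_add_le {Λ : ℝ → ℝ → ℝ} (hΛ : IsAdmissibleMean Λ) {Q : X → X → ℝ}
    (hQ : ∀ x y, 0 ≤ Q x y) {μ ν : X → ℝ} (hμ : ∀ x, 0 ≤ μ x) (hν : ∀ x, 0 ≤ ν x) {a b : ℝ}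
    (ha : 0 ≤ a) (hb : 0 ≤ b) (x y : X) :
    a * edgeWeight Λ Q μ x y + b * edgeWeight Λ Q ν x y
      ≤ edgeWeight Λ Q (a • μ + b • ν) x y := by
  have h1 := fun x y => mul_nonneg (hμ x) (hQ x y)
  have h2 := fun x y => mul_nonneg (hν x) (hQ x y)
  unfold edgeWeight
  rw [← hΛ.homogeneous' ha (h1 x y) (h1 y x), ← hΛ.homogeneous' hb (h2 x y) (h2 y x)]
  refine (hΛ.add_le (mul_nonneg ha (h1 x y)) (mul_nonneg ha (h1 y x))
    (mul_nonneg hb (h2 x y)) (mul_nonneg hb (h2 y x))).trans_eq ?_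
  congr 1 <;> simp <;> ring

variable [Fintype X]

lemma transportDist_clip (Λ : ℝ → ℝ → ℝ) (Q : X → X → ℝ) (μ₀ μ₁ : X → ℝ) :
    transportDist (clip Λ) Q μ₀ μ₁ = transportDist Λ Q μ₀ μ₁ := by
  simp only [transportDist, action, actionDensity_clip]

lemma HJ_clip (Λ : ℝ → ℝ → ℝ) {Q : X → X → ℝ} (hQ : ∀ x y, 0 ≤ Q x y) (T : ℝ) :
    HJ (clip Λ) Q T = HJ Λ Q T := by
  have h : ∀ μ ∈ stdSimplex ℝ X, ∀ Φ, normSq (clip Λ) Q μ Φ = normSq Λ Q μ Φ := fun μ hμ Φ => by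
    simp only [normSq, edgeWeight_clip Λ hQ hμ.1]
  ext φ
  refine exists_congr fun φ' => and_congr Iff.rfl ?_
  have : ∀ t, (∀ μ ∈ stdSimplex ℝ X,
      ip (φ' t) μ + (1 / 2) * normSq (clip Λ) Q μ (grad (φ t)) ≤ 0) ↔ ∀ μ ∈ stdSimplex ℝ X,
      ip (φ' t) μ + (1 / 2) * normSq Λ Q μ (grad (φ t)) ≤ 0 := fun t =>
    forall₂_congr fun μ hμ => by rw [h μ hμ]
  simp only [this]

/-! ### The Hamiltonian: concave in the measure, convex in the potential. -/

/-- The Hamiltonian `⟨p, μ⟩ + ½ ‖∇φ‖²_μ`. -/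
def ham (Λ : ℝ → ℝ → ℝ) (Q : X → X → ℝ) (p φ μ : X → ℝ) : ℝ :=
  ip p μ + (1 / 2) * normSq Λ Q μ (grad φ)

lemma continuous_ham {Λ : ℝ → ℝ → ℝ} (hc : Continuous fun p : ℝ × ℝ => Λ p.1 p.2)
    (Q : X → X → ℝ) :
    Continuous fun z : (X → ℝ) × (X → ℝ) × (X → ℝ) => ham Λ Q z.1 z.2.1 z.2.2 := by
  have h : ∀ x y, Continuous fun z : (X → ℝ) × (X → ℝ) × (X → ℝ) =>
      edgeWeight Λ Q z.2.2 x y := fun x y =>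
    (continuous_edgeWeight hc Q x y).comp (f := fun z : (X → ℝ) × (X → ℝ) × (X → ℝ) => z.2.2)
      (by fun_prop)
  unfold ham ip normSq grad
  fun_prop

lemma ham_concave {Λ : ℝ → ℝ → ℝ} (hΛ : IsAdmissibleMean Λ) {Q : X → X → ℝ}
    (hQ : ∀ x y, 0 ≤ Q x y) (p φ : X → ℝ) {μ ν : X → ℝ} (hμ : ∀ x, 0 ≤ μ x) (hν : ∀ x, 0 ≤ ν x)
    {a b : ℝ} (ha : 0 ≤ a) (hb : 0 ≤ b) :
    a * ham Λ Q p φ μ + b * ham Λ Q p φ ν ≤ ham Λ Q p φ (a • μ + b • ν) := by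
  have h1 : a * ip p μ + b * ip p ν = ip p (a • μ + b • ν) := by
    simp only [ip, Finset.mul_sum, ← Finset.sum_add_distrib]
    refine Finset.sum_congr rfl fun x _ => ?_
    simp; ring
  have h2 : a * normSq Λ Q μ (grad φ) + b * normSq Λ Q ν (grad φ)
      ≤ normSq Λ Q (a • μ + b • ν) (grad φ) := by
    simp only [normSq, Finset.mul_sum, ← Finset.sum_add_distrib]
    refine Finset.sum_le_sum fun x _ => Finset.sum_le_sum fun y _ => ?_
    nlinarith [mul_le_mul_of_nonneg_left (edgeWeight_add_le hΛ hQ hμ hν ha hb x y)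
      (sq_nonneg (grad φ x y))]
  unfold ham
  linarith

lemma ham_convex {Λ : ℝ → ℝ → ℝ} (hΛ : IsAdmissibleMean Λ) {Q : X → X → ℝ}
    (hQ : ∀ x y, 0 ≤ Q x y) (p φ p' φ' : X → ℝ) {μ : X → ℝ} (hμ : ∀ x, 0 ≤ μ x)
    {a b : ℝ} (ha : 0 ≤ a) (hb : 0 ≤ b) (hab : a + b = 1) :
    ham Λ Q (a • p + b • p') (a • φ + b • φ') μ ≤ a * ham Λ Q p φ μ + b * ham Λ Q p' φ' μ := by
  have h1 : ip (a • p + b • p') μ = a * ip p μ + b * ip p' μ := by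
    simp only [ip, Finset.mul_sum, ← Finset.sum_add_distrib]
    refine Finset.sum_congr rfl fun x _ => ?_
    simp; ring
  have h2 : normSq Λ Q μ (grad (a • φ + b • φ'))
      ≤ a * normSq Λ Q μ (grad φ) + b * normSq Λ Q μ (grad φ') := by
    simp only [normSq, Finset.mul_sum, ← Finset.sum_add_distrib]
    refine Finset.sum_le_sum fun x _ => Finset.sum_le_sum fun y _ => ?_
    have h := edgeWeight_nonneg hΛ hQ hμ x y
    have h3 : (grad (a • φ + b • φ') x y) ^ 2 ≤ a * grad φ x y ^ 2 + b * grad φ' x y ^ 2 := by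
      have : grad (a • φ + b • φ') x y = a * grad φ x y + b * grad φ' x y := by
        simp [grad]; ring
      rw [this]
      obtain rfl : b = 1 - a := by linarith
      nlinarith [mul_nonneg (mul_nonneg ha hb) (sq_nonneg (grad φ x y - grad φ' x y))]
    nlinarith [mul_le_mul_of_nonneg_right h3 h]
  unfold ham
  linarith

lemma ip_smul_add (a b : ℝ) (p p' μ : X → ℝ) :
    ip (a • p + b • p') μ = a * ip p μ + b * ip p' μ := by
  simp only [ip, Finset.mul_sum, ← Finset.sum_add_distrib]
  refine Finset.sum_congr rfl fun x _ => ?_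
  simp; ring

/-! ### Discrete integration by parts and fluxes along the edges. -/

/-- Discrete integration by parts. -/
lemma ip_divergence (φ : X → ℝ) (V : X → X → ℝ) :
    ip φ (fun x => -divergence V x) = (1 / 2) * ∑ x, ∑ y, grad φ x y * V x y := by
  have : ∑ x, ∑ y, φ x * V y x = ∑ x, ∑ y, φ y * V x y := Finset.sum_comm
  simp only [ip, divergence, grad, sub_mul, Finset.sum_sub_distrib, mul_neg, Finset.mul_sum,
    mul_sub, Finset.sum_neg_distrib] at this ⊢
  have e1 : ∑ x, ∑ y, φ x * (1 / 2 * V y x) = (1 / 2) * ∑ x, ∑ y, φ y * V x y := by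
    rw [← this]; simp only [Finset.mul_sum]
    exact Finset.sum_congr rfl fun _ _ => Finset.sum_congr rfl fun _ _ => by ring
  have e2 : ∑ x, ∑ y, φ x * (1 / 2 * V x y) = ∑ x, ∑ y, 1 / 2 * (φ x * V x y) :=
    Finset.sum_congr rfl fun _ _ => Finset.sum_congr rfl fun _ _ => by ring
  rw [e1, e2]
  simp only [Finset.mul_sum]
  ring

lemma divergence_add (V W : X → X → ℝ) (x : X) :
    divergence (V + W) x = divergence V x + divergence W x := by
  simp only [divergence, ← mul_add, ← Finset.sum_add_distrib]
  congr 1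
  exact Finset.sum_congr rfl fun y _ => by simp; ring

lemma divergence_smul (c : ℝ) (V : X → X → ℝ) (x : X) :
    divergence (c • V) x = c * divergence V x := by
  simp only [divergence, Finset.mul_sum]
  exact Finset.sum_congr rfl fun y _ => by simp; ring

lemma divergence_sum {ι : Type*} (s : Finset ι) (V : ι → X → X → ℝ) (x : X) :
    divergence (∑ i ∈ s, V i) x = ∑ i ∈ s, divergence (V i) x := by
  classical
  induction s using Finset.induction_on with
  | empty => simp [divergence]
  | insert i s hi ih => rw [Finset.sum_insert hi, Finset.sum_insert hi, divergence_add, ih]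

/-- A path of positive rates carries a unit flux from its starting point to its end point. -/
lemma exists_flux_of_reflTransGen [DecidableEq X] {Q : X → X → ℝ} {a b : X}
    (h : Relation.ReflTransGen (fun a b => 0 < Q a b) a b) :
    ∃ F : X → X → ℝ, (∀ x y, Q x y = 0 → F x y = 0) ∧
      ∀ x, divergence F x = (Pi.single a 1 : X → ℝ) x - (Pi.single b 1 : X → ℝ) x := by
  induction h with
  | refl => exact ⟨0, by simp, by simp [divergence]⟩
  | @tail b c _ hbc ih =>
    obtain ⟨F, h1, h2⟩ := ih
    -- The weight is 2 because the divergence carries a factor ½: the new edge moves one unit from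
    -- `b` to `c`.
    refine ⟨F + fun x y => if x = b ∧ y = c then 2 else 0, fun x y hxy => ?_, fun x => ?_⟩
    · have : ¬ (x = b ∧ y = c) := by rintro ⟨rfl, rfl⟩; exact hbc.ne' hxy
      simp [h1 x y hxy, this]
    · rw [divergence_add, h2]
      have : divergence (fun x y => if x = b ∧ y = c then (2 : ℝ) else 0) x
          = (Pi.single b 1 : X → ℝ) x - (Pi.single c 1 : X → ℝ) x := by
        simp only [divergence, Finset.sum_sub_distrib]
        have e1 : ∑ y, (if x = b ∧ y = c then (2 : ℝ) else 0) = if x = b then 2 else 0 := by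
          by_cases hx : x = b <;> simp [hx]
        have e2 : ∑ y, (if y = b ∧ x = c then (2 : ℝ) else 0) = if x = c then 2 else 0 := by
          by_cases hx : x = c <;> simp [hx]
        rw [e1, e2]
        simp only [Pi.single_apply]
        split_ifs <;> norm_num
      rw [this]; ring

variable {Q : X → X → ℝ} {π : X → ℝ}

/-- Some state has mass since the total is one; detailed balance passes positivity along each edge,
and irreducibility reaches every state. -/
lemma IsMarkovTriple.pi_pos (hQ : IsMarkovTriple Q π) (x : X) : 0 < π x := by
  obtain ⟨z, hz⟩ : ∃ z, 0 < π z := by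
    by_contra! h
    have : ∑ x, π x ≤ 0 := Finset.sum_nonpos fun x _ => h x
    rw [hQ.prob.2] at this
    linarith
  induction hQ.irreducible z x with
  | refl => exact hz
  | @tail b c _ hbc ih =>
    have h := hQ.detailed_balance b c
    have h1 : 0 < π c * Q c b := h ▸ mul_pos ih hbc
    exact pos_of_mul_pos_left h1 (hQ.rate_nonneg c b)

lemma IsMarkovTriple.rate_eq_zero (hQ : IsMarkovTriple Q π) {x y : X} (h : Q x y = 0) :
    Q y x = 0 := by
  have := hQ.detailed_balance x y
  rw [h, mul_zero, eq_comm] at this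
  exact (mul_eq_zero.1 this).resolve_left (hQ.pi_pos y).ne'

/-- A flux field, supported on the edges, that is linear in `μ` and has divergence `μ - π` for
probability vectors `μ`. -/
lemma IsMarkovTriple.exists_flux (hQ : IsMarkovTriple Q π) :
    ∃ G : X → X → X → ℝ, (∀ z x y, Q x y = 0 → G z x y = 0) ∧
      ∀ ν : X → ℝ, ∀ x, divergence (∑ z, ν z • G z) x = ν x - (∑ z, ν z) * π x := by
  classical
  choose F hF1 hF2 using fun a b => exists_flux_of_reflTransGen (hQ.irreducible a b)
  have hdiv : ∀ z x, divergence (∑ b, π b • F z b) x = (Pi.single z 1 : X → ℝ) x - π x := by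
    intro z x
    rw [divergence_sum]
    simp only [divergence_smul, hF2, mul_sub, Finset.sum_sub_distrib, ← Finset.sum_mul, hQ.prob.2,
      one_mul]
    simp [Pi.single_apply]
  -- `G z` distributes the unit mass at `z` over the targets `b` in the proportions `π b`.
  refine ⟨fun z => ∑ b, π b • F z b, fun z x y h => ?_, fun ν x => ?_⟩
  · simp [Finset.sum_apply, hF1 _ _ x y h]
  · rw [divergence_sum]
    simp only [divergence_smul, hdiv, mul_sub, Finset.sum_sub_distrib, ← Finset.sum_mul]
    simp [Pi.single_apply]

end

/-! ### Weak derivatives and primitives on an interval. -/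

lemma absolutelyContinuousOnInterval_primitive {v : ℝ → ℝ} {a b : ℝ}
    (hv : IntervalIntegrable v volume a b) (c : ℝ) :
    AbsolutelyContinuousOnInterval (fun t => c + ∫ s in a..t, v s) a b := by
  have h1 : AbsolutelyContinuousOnInterval (fun _ : ℝ => c) a b :=
    ContDiffOn.absolutelyContinuousOnInterval contDiffOn_const
  exact h1.add (hv.absolutelyContinuousOnInterval_intervalIntegral left_mem_uIcc)

/-- The product rule for primitives of integrable functions. -/
lemma integral_mul_add_mul_primitive {v q : ℝ → ℝ} {a b : ℝ} (c d : ℝ)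
    (hv : IntervalIntegrable v volume a b) (hq : IntervalIntegrable q volume a b) :
    ∫ t in a..b, (v t * (d + ∫ s in a..t, q s) + (c + ∫ s in a..t, v s) * q t)
      = (c + ∫ s in a..b, v s) * (d + ∫ s in a..b, q s) - c * d := by
  have h := (absolutelyContinuousOnInterval_primitive hv c).integral_deriv_mul_eq_sub
    (absolutelyContinuousOnInterval_primitive hq d)
  simp only [intervalIntegral.integral_same, add_zero] at h
  rw [← h]
  refine intervalIntegral.integral_congr_ae ?_
  filter_upwards [hv.ae_hasDerivAt_integral, hq.ae_hasDerivAt_integral] with t h1 h2 ht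
  have ht' := uIoc_subset_uIcc ht
  rw [((h1 ht' a left_mem_uIcc).const_add c).deriv, ((h2 ht' a left_mem_uIcc).const_add d).deriv]

lemma exists_Icc_of_isCompact_subset_Ioo {K : Set ℝ} (hK : IsCompact K) {T : ℝ} (hT : 0 < T)
    (h : K ⊆ Ioo 0 T) : ∃ a b, 0 < a ∧ a ≤ b ∧ b < T ∧ K ⊆ Icc a b := by
  rcases K.eq_empty_or_nonempty with rfl | hne
  · exact ⟨T / 2, T / 2, by linarith, le_rfl, by linarith, empty_subset _⟩
  · exact ⟨sInf K, sSup K, (h (hK.sInf_mem hne)).1, csInf_le_csSup hne hK.bddBelow hK.bddAbove,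
      (h (hK.sSup_mem hne)).2,
      fun x hx => ⟨csInf_le hK.bddBelow hx, le_csSup hK.bddAbove hx⟩⟩

/-- A test function with vanishing mean is the derivative of a test function. -/
lemma exists_primitive_test {T : ℝ} (hT : 0 < T) {g : ℝ → ℝ} (hg : ContDiff ℝ ∞ g)
    (hgc : HasCompactSupport g) (hgs : tsupport g ⊆ Ioo 0 T) (hg0 : ∫ t in (0 : ℝ)..T, g t = 0) :
    ∃ η : ℝ → ℝ, ContDiff ℝ ∞ η ∧ HasCompactSupport η ∧ tsupport η ⊆ Ioo 0 T ∧ deriv η = g := by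
  obtain ⟨a, b, ha, hab, hb, hK⟩ := exists_Icc_of_isCompact_subset_Ioo hgc hT hgs
  have hgz : ∀ t, t ∉ Icc a b → g t = 0 := fun t ht =>
    image_eq_zero_of_notMem_tsupport fun h => ht (hK h)
  have hd : ∀ t, HasDerivAt (fun t => ∫ s in (0 : ℝ)..t, g s) (g t) t := fun t =>
    intervalIntegral.integral_hasDerivAt_right (hg.continuous.intervalIntegrable _ _)
      hg.continuous.aestronglyMeasurable.stronglyMeasurableAtFilter hg.continuous.continuousAt
  have hderiv : deriv (fun t => ∫ s in (0 : ℝ)..t, g s) = g := funext fun t => (hd t).deriv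
  have hsupp : Function.support (fun t => ∫ s in (0 : ℝ)..t, g s) ⊆ Icc a b := by
    intro t ht
    by_contra hn
    apply ht
    rcases lt_or_ge t a with h | h
    · show ∫ s in (0 : ℝ)..t, g s = 0
      rw [intervalIntegral.integral_congr (g := fun _ => 0), intervalIntegral.integral_zero]
      intro s hs
      refine hgz s fun hs' => ?_
      have : s ≤ max 0 t := hs.2
      have := max_lt ha h
      linarith [hs'.1]
    · have h' : b < t := by by_contra! h2; exact hn ⟨h, h2⟩
      -- To the right of the support the primitive equals the full integral, which vanishes by the
      -- mean-zero hypothesis.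
      have e : ∫ s in (0 : ℝ)..t, g s = (∫ s in (0 : ℝ)..T, g s) + ∫ s in T..t, g s :=
        (intervalIntegral.integral_add_adjacent_intervals
          (hg.continuous.intervalIntegrable _ _) (hg.continuous.intervalIntegrable _ _)).symm
      show ∫ s in (0 : ℝ)..t, g s = 0
      rw [e, hg0, zero_add, intervalIntegral.integral_congr (g := fun _ => 0),
        intervalIntegral.integral_zero]
      intro s hs
      refine hgz s fun hs' => ?_
      have : min T t ≤ s := hs.1
      have := lt_min hb h'
      linarith [hs'.2]
  have hts : tsupport (fun t => ∫ s in (0 : ℝ)..t, g s) ⊆ Icc a b :=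
    closure_minimal hsupp isClosed_Icc
  refine ⟨fun t => ∫ s in (0 : ℝ)..t, g s, ?_, ?_, ?_, hderiv⟩
  · rw [contDiff_infty_iff_deriv]
    exact ⟨fun t => (hd t).differentiableAt, by rw [hderiv]; exact hg⟩
  · exact HasCompactSupport.intro' isCompact_Icc isClosed_Icc fun t ht => by
      by_contra h
      exact ht (hsupp h)
  · exact hts.trans fun t ht => ⟨ha.trans_le ht.1, ht.2.trans_lt hb⟩

lemma test_eq_zero_of_notMem {T : ℝ} {η : ℝ → ℝ} (hs : tsupport η ⊆ Ioo 0 T) {t : ℝ}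
    (ht : t ∉ Ioo 0 T) : η t = 0 :=
  image_eq_zero_of_notMem_tsupport fun h => ht (hs h)

lemma setIntegral_Ioo_eq_intervalIntegral {T : ℝ} (hT : 0 ≤ T) (f : ℝ → ℝ) :
    ∫ t in Ioo 0 T, f t = ∫ t in (0 : ℝ)..T, f t := by
  rw [intervalIntegral.integral_of_le hT, integral_Ioc_eq_integral_Ioo]

/-- A continuous function with vanishing weak derivative is constant. -/
lemma eq_const_of_hasWeakDeriv_zero {T : ℝ} (hT : 0 < T) {w : ℝ → ℝ}
    (hw : ContinuousOn w (Icc 0 T)) (h : HasWeakDeriv T w 0) : ∀ t ∈ Icc 0 T, w t = w 0 := by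
  -- A test function `r` of unit mass. For a test function `g` of mean `m`, `g - m * r` has mean
  -- zero and so is the derivative of a test function; hence `w` integrates against `g` as the
  -- constant `c` does.
  let ρ : ContDiffBump (T / 2) := ⟨T / 8, T / 4, by linarith, by linarith⟩
  set r : ℝ → ℝ := ρ.normed volume with hr
  have hrc : ContDiff ℝ ∞ r := ρ.contDiff_normed
  have hrs : tsupport r ⊆ Ioo 0 T := by
    rw [hr, ρ.tsupport_normed_eq, Real.closedBall_eq_Icc]
    intro t ht
    have h1 : T / 2 - T / 4 ≤ t := ht.1
    have h2 : t ≤ T / 2 + T / 4 := ht.2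
    constructor <;> linarith
  have hint : ∀ {g : ℝ → ℝ}, tsupport g ⊆ Ioo 0 T → ∀ f : ℝ → ℝ,
      ∫ t in Ioo 0 T, f t * g t = ∫ t, f t * g t := fun {g} hg f =>
    setIntegral_eq_integral_of_forall_compl_eq_zero fun t ht => by
      rw [test_eq_zero_of_notMem hg ht, mul_zero]
  have hwint : ∀ {g : ℝ → ℝ}, Continuous g → IntegrableOn (fun t => w t * g t) (Ioo 0 T) :=
    fun {g} hg => ((hw.mul hg.continuousOn).integrableOn_Icc).mono_set Ioo_subset_Icc_self
  have hr1 : ∫ t in Ioo 0 T, r t = 1 := by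
    have := hint hrs (fun _ => 1)
    simp only [one_mul] at this
    rw [this]
    exact ρ.integral_normed
  set c := ∫ t in Ioo 0 T, w t * r t with hc
  have key : ∀ᵐ t, t ∈ Ioo 0 T → w t - c = 0 := by
    refine isOpen_Ioo.ae_eq_zero_of_integral_contDiff_smul_eq_zero ?_ ?_
    · exact (((hw.sub continuousOn_const).integrableOn_Icc).mono_set
        Ioo_subset_Icc_self).locallyIntegrableOn
    · intro g hg hgc hgs
      set m := ∫ t in Ioo 0 T, g t with hm
      have hgi : IntegrableOn g (Ioo 0 T) :=
        (hg.continuous.continuousOn.integrableOn_Icc).mono_set Ioo_subset_Icc_self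
      have hri : IntegrableOn r (Ioo 0 T) :=
        (hrc.continuous.continuousOn.integrableOn_Icc).mono_set Ioo_subset_Icc_self
      obtain ⟨η, h1, h2, h3, h4⟩ := exists_primitive_test hT (g := fun t => g t - m * r t)
        (hg.sub (contDiff_const.mul hrc)) (hgc.sub (ρ.hasCompactSupport_normed.mul_left))
        ((tsupport_sub _ _).trans (union_subset hgs
          ((tsupport_mul_subset_right (f := fun _ => m) (g := r)).trans hrs))) (by
            rw [← setIntegral_Ioo_eq_intervalIntegral hT.le, integral_sub hgi (hri.const_mul m),
              integral_const_mul, hr1, mul_one, sub_self])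
      have := h η h1 h2 h3
      rw [h4] at this
      simp only [Pi.zero_apply, zero_mul, integral_zero, neg_zero] at this
      have e1 : ∫ t in Ioo 0 T, w t * (g t - m * r t)
          = (∫ t in Ioo 0 T, w t * g t) - m * c := by
        rw [hc, ← integral_const_mul, ← integral_sub (hwint hg.continuous)
          ((hwint hrc.continuous).const_mul m)]
        exact integral_congr_ae (.of_forall fun t => by simp; ring)
      have e2 : ∫ t, g t • (w t - c) = ∫ t in Ioo 0 T, (w t - c) * g t := by
        rw [hint hgs]
        exact integral_congr_ae (.of_forall fun t => by simp [mul_comm])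
      rw [e2]
      have e3 : ∫ t in Ioo 0 T, (w t - c) * g t
          = (∫ t in Ioo 0 T, w t * g t) - c * m := by
        rw [hm, ← integral_const_mul, ← integral_sub (hwint hg.continuous) (hgi.const_mul c)]
        exact integral_congr_ae (.of_forall fun t => by simp; ring)
      rw [e3]
      linarith
  have hae : w =ᵐ[volume.restrict (Icc 0 T)] fun _ => c := by
    rw [Measure.restrict_congr_set Ioo_ae_eq_Icc.symm]
    exact (ae_restrict_iff' measurableSet_Ioo).2 (key.mono fun t ht h => sub_eq_zero.1 (ht h))
  have heq := Measure.eqOn_Icc_of_ae_eq volume hT.ne hae hw continuousOn_const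
  intro t ht
  rw [heq ht, heq (left_mem_Icc.2 hT.le)]

/-- Integration by parts keeping the boundary terms. They drop out for compactly supported test
functions, and carry the prescribed end values in `eq_primitive_of_weak_boundary`. -/
lemma intervalIntegral_mul_deriv_test {T : ℝ} (hT : 0 < T) {v : ℝ → ℝ} (c : ℝ)
    (hv : IntervalIntegrable v volume 0 T) {η : ℝ → ℝ} (hη : ContDiff ℝ 1 η) :
    ∫ t in Ioo 0 T, (c + ∫ s in (0 : ℝ)..t, v s) * deriv η t
      = (c + ∫ s in (0 : ℝ)..T, v s) * η T - c * η 0 - ∫ t in Ioo 0 T, v t * η t := by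
  have hd : ∀ t, HasDerivAt η (deriv η t) t := fun t =>
    (hη.differentiable one_ne_zero t).hasDerivAt
  have hi : IntervalIntegrable (deriv η) volume 0 T :=
    (hη.continuous_deriv le_rfl).intervalIntegrable _ _
  have hη' : ∀ t, η 0 + ∫ s in (0 : ℝ)..t, deriv η s = η t := fun t => by
    rw [intervalIntegral.integral_deriv_eq_sub (fun x _ => (hd x).differentiableAt)
      ((hη.continuous_deriv le_rfl).intervalIntegrable _ _)]
    ring
  have h := integral_mul_add_mul_primitive c (η 0) hv hi
  simp only [hη'] at h
  rw [intervalIntegral.integral_add] at h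
  · rw [setIntegral_Ioo_eq_intervalIntegral hT.le, setIntegral_Ioo_eq_intervalIntegral hT.le]
    linarith
  · exact hv.mul_continuousOn hη.continuous.continuousOn
  · exact hi.continuousOn_mul (absolutelyContinuousOnInterval_primitive hv c).continuousOn

/-- A continuous function with integrable weak derivative is the primitive of the latter. -/
lemma HasWeakDeriv.eq_primitive {T : ℝ} (hT : 0 < T) {u v : ℝ → ℝ}
    (hu : ContinuousOn u (Icc 0 T)) (hv : IntegrableOn v (Ioo 0 T)) (h : HasWeakDeriv T u v) :
    ∀ t ∈ Icc 0 T, u t = u 0 + ∫ s in (0 : ℝ)..t, v s := by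
  have hv' : IntervalIntegrable v volume 0 T := by
    rw [intervalIntegrable_iff, uIoc_of_le hT.le, integrableOn_Ioc_iff_integrableOn_Ioo]
    exact hv
  have hcont : ContinuousOn (fun t => 0 + ∫ s in (0 : ℝ)..t, v s) (Icc 0 T) := by
    have := (absolutelyContinuousOnInterval_primitive hv' 0).continuousOn
    rwa [uIcc_of_le hT.le] at this
  have := eq_const_of_hasWeakDeriv_zero hT (hu.sub hcont) (by
    intro η h1 h2 h3
    have e0 := test_eq_zero_of_notMem h3 (t := 0) (by simp)
    have eT := test_eq_zero_of_notMem h3 (t := T) (by simp)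
    have h4 := intervalIntegral_mul_deriv_test hT 0 hv' (h1.of_le (by simp))
    have hdc := h1.continuous_deriv (by simp)
    have i1 : IntegrableOn (fun t => u t * deriv η t) (Ioo 0 T) :=
      ((hu.mul hdc.continuousOn).integrableOn_Icc).mono_set Ioo_subset_Icc_self
    have i2 : IntegrableOn (fun t => (0 + ∫ s in (0 : ℝ)..t, v s) * deriv η t) (Ioo 0 T) :=
      ((hcont.mul hdc.continuousOn).integrableOn_Icc).mono_set Ioo_subset_Icc_self
    simp only [Pi.sub_apply, sub_mul]
    rw [integral_sub i1 i2, h4, h η h1 h2 h3, e0, eT]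
    simp)
  intro t ht
  have := this t ht
  simp at this
  linarith

/-- The primitive of an integrable function has that function as its weak derivative. -/
lemma hasWeakDeriv_primitive {T : ℝ} (hT : 0 < T) {v : ℝ → ℝ} (c : ℝ)
    (hv : IntervalIntegrable v volume 0 T) :
    HasWeakDeriv T (fun t => c + ∫ s in (0 : ℝ)..t, v s) v := by
  intro η h1 h2 h3
  rw [intervalIntegral_mul_deriv_test hT c hv (h1.of_le (by simp)),
    test_eq_zero_of_notMem h3 (t := 0) (by simp), test_eq_zero_of_notMem h3 (t := T) (by simp)]
  simp

/-! ### Weak duality. -/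

lemma ofReal_sum_le {ι : Type*} (s : Finset ι) (f : ι → ℝ) :
    ENNReal.ofReal (∑ i ∈ s, f i) ≤ ∑ i ∈ s, ENNReal.ofReal (f i) :=
  Finset.le_sum_of_subadditive ENNReal.ofReal ENNReal.ofReal_zero.le
    (fun _ _ => ENNReal.ofReal_add_le) s f

lemma ofReal_integral_le_lintegral {α : Type*} [MeasurableSpace α] {ν : Measure α} {f : α → ℝ}
    (hf : Integrable f ν) : ENNReal.ofReal (∫ t, f t ∂ν) ≤ ∫⁻ t, ENNReal.ofReal (f t) ∂ν := by
  rw [integral_eq_lintegral_pos_part_sub_lintegral_neg_part hf]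
  refine (ENNReal.ofReal_le_ofReal (sub_le_self _ ENNReal.toReal_nonneg)).trans ?_
  exact ENNReal.ofReal_toReal_le

/-- Fenchel–Young for w ↦ w²/Λ: expand (w - rΛ)² ≥ 0. On the boundary, finite action forces w = 0,
and then the left side is nonpositive. -/
lemma le_actionDensity {Λ : ℝ → ℝ → ℝ} (hΛ : IsAdmissibleMean Λ) (s t w r : ℝ) :
    ENNReal.ofReal (2 * r * w - r ^ 2 * Λ s t) ≤ actionDensity Λ s t w := by
  unfold actionDensity
  split_ifs with h1 h2
  · refine ENNReal.ofReal_le_ofReal ?_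
    have hp := hΛ.pos h1.1 h1.2
    rw [le_div_iff₀ hp]
    nlinarith [sq_nonneg (w - r * Λ s t)]
  · rw [h2.1]
    have := hΛ.nonneg s t h2.2.1 h2.2.2
    refine (ENNReal.ofReal_eq_zero.2 ?_).le
    nlinarith [mul_nonneg (sq_nonneg r) this]
  · exact le_top

section

variable {X : Type*} [Fintype X]

lemma le_action {Λ : ℝ → ℝ → ℝ} (hΛ : IsAdmissibleMean Λ) (Q : X → X → ℝ) (μ : X → ℝ)
    (V Φ : X → X → ℝ) :
    ENNReal.ofReal (∑ x, ∑ y, Φ x y * V x y - normSq Λ Q μ Φ) ≤ action Λ Q μ V := by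
  have e : ∑ x, ∑ y, Φ x y * V x y - normSq Λ Q μ Φ
      = (1 / 2) * ∑ x, ∑ y, (2 * Φ x y * V x y - Φ x y ^ 2 * edgeWeight Λ Q μ x y) := by
    simp only [normSq, mul_sub, Finset.mul_sum,
      ← Finset.sum_sub_distrib]
    exact Finset.sum_congr rfl fun x _ => Finset.sum_congr rfl fun y _ => by ring
  rw [e, ENNReal.ofReal_mul (by norm_num)]
  have h2 : ENNReal.ofReal (1 / 2) = 1 / 2 := by
    rw [ENNReal.ofReal_div_of_pos two_pos]; simp
  rw [h2]
  unfold action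
  gcongr
  refine (ofReal_sum_le _ _).trans (Finset.sum_le_sum fun x _ => ?_)
  refine (ofReal_sum_le _ _).trans (Finset.sum_le_sum fun y _ => ?_)
  exact le_actionDensity hΛ _ _ _ _

/-- Weak duality. -/
theorem HJ_value_le_action {Λ : ℝ → ℝ → ℝ} (hΛ : IsAdmissibleMean Λ) {Q : X → X → ℝ}
    {φ : ℝ → X → ℝ} (hφ : φ ∈ HJ Λ Q 1) {μ₀ μ₁ : X → ℝ} {μ : ℝ → X → ℝ} {V : ℝ → X → X → ℝ}
    (h : IsCE 1 μ₀ μ₁ μ V) :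
    ENNReal.ofReal (2 * (ip (φ 1) μ₁ - ip (φ 0) μ₀))
      ≤ ∫⁻ t in Icc (0 : ℝ) 1, action Λ Q (μ t) (V t) := by
  obtain ⟨φ', hφ1, hae⟩ := hφ
  have hV : IntegrableOn V (Ioo 0 1) :=
    (h.locallyIntegrableOn.integrableOn_isCompact isCompact_Icc).mono_set Ioo_subset_Icc_self
  have hVxy : ∀ x y, IntegrableOn (fun t => V t x y) (Ioo 0 1) := fun x y => (hV.eval x).eval y
  have hdiv : ∀ x, IntegrableOn (fun t => -divergence (V t) x) (Ioo 0 1) := fun x => by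
    refine (Integrable.const_mul ?_ _).neg
    exact integrable_finsetSum _ fun y _ => (hVxy x y).sub (hVxy y x)
  have hφ'x : ∀ x, IntegrableOn (fun t => φ' t x) (Ioo 0 1) := fun x =>
    (hφ1.memLp_deriv.integrable one_le_two).eval x
  have key : ∀ x, IntegrableOn (fun t => φ' t x * μ t x + φ t x * -divergence (V t) x) (Ioo 0 1) ∧
      ∫ t in Ioo 0 1, (φ' t x * μ t x + φ t x * -divergence (V t) x)
        = φ 1 x * μ₁ x - φ 0 x * μ₀ x := by
    intro x
    have c1 : ContinuousOn (fun t => φ t x) (Icc 0 1) :=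
      (continuous_apply x).comp_continuousOn hφ1.continuousOn
    have c2 : ContinuousOn (fun t => μ t x) (Icc 0 1) :=
      (continuous_apply x).comp_continuousOn h.continuousOn
    have e1 := (hφ1.weakDeriv x).eq_primitive one_pos c1 (hφ'x x)
    have e2 := (h.continuity_equation x).eq_primitive one_pos c2 (hdiv x)
    have i1 : IntervalIntegrable (fun t => φ' t x) volume 0 1 := by
      rw [intervalIntegrable_iff, uIoc_of_le zero_le_one, integrableOn_Ioc_iff_integrableOn_Ioo]
      exact hφ'x x
    have i2 : IntervalIntegrable (fun t => -divergence (V t) x) volume 0 1 := by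
      rw [intervalIntegrable_iff, uIoc_of_le zero_le_one, integrableOn_Ioc_iff_integrableOn_Ioo]
      exact hdiv x
    refine ⟨?_, ?_⟩
    · have u : uIcc (0 : ℝ) 1 = Icc 0 1 := uIcc_of_le zero_le_one
      have := (i1.mul_continuousOn (u ▸ c2)).add (i2.continuousOn_mul (u ▸ c1))
      rwa [intervalIntegrable_iff, uIoc_of_le zero_le_one,
        integrableOn_Ioc_iff_integrableOn_Ioo] at this
    · have := integral_mul_add_mul_primitive (φ 0 x) (μ 0 x) i1 i2
      rw [← e1 1 (by simp), ← e2 1 (by simp), h.initial, h.terminal] at this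
      rw [← this, ← setIntegral_Ioo_eq_intervalIntegral zero_le_one]
      refine setIntegral_congr_fun measurableSet_Ioo fun t ht => ?_
      have ht' := Ioo_subset_Icc_self ht
      rw [e1 t ht', e2 t ht', h.initial]
  have hF : ip (φ 1) μ₁ - ip (φ 0) μ₀
      = ∫ t in Ioo 0 1, (ip (φ' t) (μ t) + ip (φ t) (fun x => -divergence (V t) x)) := by
    simp only [ip, ← Finset.sum_add_distrib, ← Finset.sum_sub_distrib]
    rw [integral_finsetSum _ fun x _ => (key x).1]
    exact Finset.sum_congr rfl fun x _ => ((key x).2).symm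
  have hFi : IntegrableOn
      (fun t => ip (φ' t) (μ t) + ip (φ t) (fun x => -divergence (V t) x)) (Ioo 0 1) := by
    simp only [ip, ← Finset.sum_add_distrib]
    exact integrable_finsetSum _ fun x _ => (key x).1
  rw [hF, ← integral_const_mul, ← Measure.restrict_congr_set Ioo_ae_eq_Icc]
  refine (ofReal_integral_le_lintegral (hFi.const_mul 2)).trans (lintegral_mono_ae ?_)
  filter_upwards [hae, ae_restrict_mem measurableSet_Ioo] with t ht htm
  -- Fenchel–Young is used with Φ = ∇φ, and the Hamilton–Jacobi inequality tested with `μ t` absorbs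
  -- the term ‖∇φ‖².
  refine le_trans (ENNReal.ofReal_le_ofReal ?_) (le_action hΛ Q (μ t) (V t) (grad (φ t)))
  have := ht (μ t) (h.prob t (Ioo_subset_Icc_self htm))
  rw [ip_divergence]
  linarith

end

/-! ### A minimax principle in Hilbert space. -/

section

variable {H : Type*} [NormedAddCommGroup H] [InnerProductSpace ℝ H]

/-- Parallelogram law: the midpoint of `x` and `y` lies in `C`, so its norm is at least ‖x‖. -/
lemma norm_sub_sq_le_of_minimal {C : Set H} (hC : Convex ℝ C) {x y : H} (hx : x ∈ C) (hy : y ∈ C)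
    (hmin : ∀ w ∈ C, ‖x‖ ≤ ‖w‖) : ‖y - x‖ ^ 2 ≤ 2 * (‖y‖ ^ 2 - ‖x‖ ^ 2) := by
  have hm := hmin _ (hC hx hy (show (0 : ℝ) ≤ 1 / 2 by norm_num)
    (show (0 : ℝ) ≤ 1 / 2 by norm_num) (by norm_num))
  rw [← smul_add, norm_smul, Real.norm_of_nonneg (by norm_num), add_comm x y] at hm
  have hp := parallelogram_law_with_norm ℝ y x
  have : (2 * ‖x‖) ^ 2 ≤ ‖y + x‖ ^ 2 := pow_le_pow_left₀ (by positivity) (by linarith) 2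
  nlinarith

/-- A directed family of nonempty closed convex subsets of a ball of a Hilbert space has a common
point. -/
theorem nonempty_iInter_of_directed_convex [CompleteSpace H] {ι : Type*} [Nonempty ι]
    {C : ι → Set H} (hdir : Directed (· ⊇ ·) C) (hne : ∀ i, (C i).Nonempty)
    (hcl : ∀ i, IsClosed (C i)) (hconv : ∀ i, Convex ℝ (C i)) {R : ℝ}
    (hR : ∀ i, ∀ x ∈ C i, ‖x‖ ≤ R) : (⋂ i, C i).Nonempty := by
  have hmin : ∀ i, ∃ x ∈ C i, ∀ w ∈ C i, ‖x‖ ≤ ‖w‖ := fun i => by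
    obtain ⟨x, hx, h⟩ :=
      exists_norm_eq_iInf_of_complete_convex (hne i) (hcl i).isComplete (hconv i) 0
    refine ⟨x, hx, fun w hw => ?_⟩
    simp only [zero_sub, norm_neg] at h
    rw [h]
    exact ciInf_le ⟨0, forall_mem_range.2 fun _ => norm_nonneg _⟩ (⟨w, hw⟩ : C i)
  choose x hx hxmin using hmin
  have hbdd : BddAbove (range fun i => ‖x i‖ ^ 2) := ⟨R ^ 2, forall_mem_range.2 fun i =>
    pow_le_pow_left₀ (norm_nonneg _) (hR i _ (hx i)) 2⟩
  -- Minimal norms grow as the sets shrink but stay below `R`. Along `i n` they approach the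
  -- supremum `d`, so the minimal point of any subset `C j` of `C (i n)` is within `b n` of `x (i
  -- n)`.
  set d := ⨆ i, ‖x i‖ ^ 2 with hd
  have hle : ∀ i, ‖x i‖ ^ 2 ≤ d := le_ciSup hbdd
  have hseq : ∀ n : ℕ, ∃ i, d - 1 / ((n : ℝ) + 1) < ‖x i‖ ^ 2 := fun n =>
    exists_lt_of_lt_ciSup (sub_lt_self _ Nat.one_div_pos_of_nat)
  choose i hi using hseq
  set b : ℕ → ℝ := fun n => √(2 * (1 / ((n : ℝ) + 1))) with hb
  have hb0 : Filter.Tendsto b Filter.atTop (nhds 0) := by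
    have := (tendsto_one_div_add_atTop_nhds_zero_nat (𝕜 := ℝ)).const_mul 2
    rw [mul_zero] at this
    have h2 := (Real.continuous_sqrt.tendsto 0).comp this
    rwa [Real.sqrt_zero] at h2
  have hclose : ∀ n j, C j ⊆ C (i n) → ‖x j - x (i n)‖ ≤ b n := fun n j hj => by
    refine Real.le_sqrt_of_sq_le ?_
    have := norm_sub_sq_le_of_minimal (hconv (i n)) (hx (i n)) (hj (hx j)) (hxmin (i n))
    nlinarith [hle j, hi n]
  have hcauchy : CauchySeq fun n => x (i n) := by
    refine cauchySeq_of_le_tendsto_0 (fun n => b n + b n) (fun n m N hn hm => ?_)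
      (by simpa using hb0.add hb0)
    have hanti : ∀ {n N : ℕ}, N ≤ n → b n ≤ b N := fun {n N} h => by
      refine Real.sqrt_le_sqrt (mul_le_mul_of_nonneg_left ?_ zero_le_two)
      exact Nat.one_div_le_one_div h
    obtain ⟨j, h1, h2⟩ := hdir (i n) (i m)
    rw [dist_eq_norm, ← norm_neg]
    calc ‖-(x (i n) - x (i m))‖ = ‖(x j - x (i n)) - (x j - x (i m))‖ := by congr 1; abel
      _ ≤ ‖x j - x (i n)‖ + ‖x j - x (i m)‖ := norm_sub_le _ _
      _ ≤ b N + b N := add_le_add ((hclose n j h1).trans (hanti hn))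
          ((hclose m j h2).trans (hanti hm))
  obtain ⟨z, hz⟩ := cauchySeq_tendsto_of_complete hcauchy
  refine ⟨z, mem_iInter.2 fun k => ?_⟩
  -- Sets inside both `C k` and `C (i n)` have minimal points that lie in `C k` and converge to `z`.
  choose j hj1 hj2 using fun n => hdir k (i n)
  have hlim : Filter.Tendsto (fun n => x (j n) - x (i n)) Filter.atTop (nhds 0) :=
    squeeze_zero_norm (fun n => hclose n (j n) (hj2 n)) hb0
  refine (hcl k).mem_of_tendsto (by simpa using hlim.add hz)
    (Filter.Eventually.of_forall fun n => hj1 n (hx (j n)))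

/-- The finite minimax principle for a function that is convex in the first variable and concave
in the second one. -/
theorem exists_forall_mem_finset_le {V : Type*} [AddCommGroup V] [Module ℝ V] {K : Set H}
    (hne : K.Nonempty) {S : Set V} {J : H → V → ℝ}
    (hconv : ∀ φ ∈ S, ConvexOn ℝ K fun f => J f φ) (hconc : ∀ f ∈ K, ConcaveOn ℝ S (J f)) {D : ℝ}
    (h : ∀ φ ∈ S, ∀ ε > 0, ∃ f ∈ K, J f φ ≤ D + ε) (s : Finset V) (hs : (s : Set V) ⊆ S) {ε : ℝ}
    (hε : 0 < ε) : ∃ f ∈ K, ∀ φ ∈ s, J f φ ≤ D + ε := by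
  classical
  by_contra! hcon
  -- `A` holds the vectors dominating some (J f i)ᵢ, `B` those with all entries below D + ε. The
  -- contrary assumption makes them disjoint, so a functional with weights `l` separates them.
  set A : Set (s → ℝ) := {y | ∃ f ∈ K, ∀ i : s, J f i ≤ y i} with hA
  set B : Set (s → ℝ) := univ.pi fun _ => Iio (D + ε) with hB
  have hBo : IsOpen B := isOpen_set_pi finite_univ fun _ _ => isOpen_Iio
  have hBc : Convex ℝ B := convex_pi fun _ _ => convex_Iio _
  have hKc : Convex ℝ K ∨ s = ∅ := by
    rcases s.eq_empty_or_nonempty with h | ⟨φ, hφ⟩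
    · exact Or.inr h
    · exact Or.inl (hconv φ (hs hφ)).1
  have hKc : Convex ℝ K := hKc.resolve_right fun h0 => by
    obtain ⟨f, hf⟩ := hne
    obtain ⟨φ, hφ, _⟩ := hcon f hf
    simp [h0] at hφ
  have hAc : Convex ℝ A := by
    rintro y ⟨f, hf, hy⟩ y' ⟨f', hf', hy'⟩ a b ha hb hab
    refine ⟨a • f + b • f', hKc hf hf' ha hb hab, fun i => ?_⟩
    refine ((hconv i (hs i.2)).2 hf hf' ha hb hab).trans ?_
    simp only [Pi.add_apply, Pi.smul_apply, smul_eq_mul]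
    exact add_le_add (mul_le_mul_of_nonneg_left (hy i) ha) (mul_le_mul_of_nonneg_left (hy' i) hb)
  have hdisj : Disjoint B A := by
    rw [disjoint_left]
    rintro y hyB ⟨f, hf, hy⟩
    obtain ⟨φ, hφ, hlt⟩ := hcon f hf
    have h1 := hy ⟨φ, hφ⟩
    have h2 : y ⟨φ, hφ⟩ < D + ε := hyB ⟨φ, hφ⟩ (mem_univ _)
    linarith
  obtain ⟨F, u, hFB, hFA⟩ := geometric_hahn_banach_open hBc hBo hAc hdisj
  set l : s → ℝ := fun i => F (Pi.single i 1) with hl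
  have hF : ∀ y, F y = ∑ i, y i * l i := fun y => by
    conv_lhs => rw [pi_eq_sum_univ' y]
    simp only [map_sum, map_smul, smul_eq_mul, hl]
  -- `B` is unbounded below in every coordinate while the functional is bounded above on it, so no
  -- weight is negative.
  have hl0 : ∀ i, 0 ≤ l i := by
    intro i
    by_contra! hlt
    set c : s → ℝ := fun _ => D with hc
    set N := max 0 ((u - F c) / (-l i)) with hN
    have hmem : c - N • Pi.single i 1 ∈ B := fun j _ => by
      have h1 : (Pi.single i 1 : s → ℝ) j ≥ 0 := by
        rw [Pi.single_apply]; split_ifs <;> norm_num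
      have h2 : 0 ≤ N := le_max_left _ _
      simp only [Pi.sub_apply, Pi.smul_apply, smul_eq_mul, mem_Iio, hc]
      nlinarith [mul_nonneg h2 h1]
    have h1 := hFB _ hmem
    rw [map_sub, map_smul, smul_eq_mul] at h1
    have h2 : (u - F c) / (-l i) ≤ N := le_max_right _ _
    rw [div_le_iff₀ (by linarith)] at h2
    have h3 : F (Pi.single i 1) = l i := rfl
    rw [h3] at h1
    linarith
  set L := ∑ i, l i with hL
  have hL0 : 0 < L := by
    refine lt_of_le_of_ne (Finset.sum_nonneg fun i _ => hl0 i) fun h0 => ?_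
    have hz : ∀ i, l i = 0 := fun i =>
      (Finset.sum_eq_zero_iff_of_nonneg fun i _ => hl0 i).1 h0.symm i (Finset.mem_univ i)
    obtain ⟨f, hf⟩ := hne
    have h1 := hFB (fun _ => D) (fun _ _ => by simpa using hε)
    have h2 := hFA (fun i => J f i) ⟨f, hf, fun _ => le_rfl⟩
    rw [hF] at h1 h2
    simp only [hz, mul_zero, Finset.sum_const_zero] at h1 h2
    linarith
  have hw1 : ∑ i, l i / L = 1 := by rw [← Finset.sum_div, ← hL, div_self hL0.ne']
  obtain ⟨φ₀, hφ₀⟩ : s.Nonempty := by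
    by_contra h0
    rw [Finset.not_nonempty_iff_eq_empty] at h0
    subst h0
    simp at hL
    exact hL0.ne' hL
  have hSc : Convex ℝ S := (hconc hne.some hne.some_mem).1
  -- The hypothesis is applied to the convex combination with weights `l i / L`. Concavity bounds
  -- the weighted mean of the J f i by D + ε/2, whereas separation from the constant vector D + ε/2
  -- in `B` makes that mean larger.
  obtain ⟨f, hf, hJ⟩ := h (∑ i, (l i / L) • (i : V))
    (hSc.sum_mem (fun i _ => div_nonneg (hl0 i) hL0.le) hw1 fun i _ => hs i.2) (ε / 2) (half_pos hε)
  have hjen := (hconc f hf).le_map_sum (t := Finset.univ) (w := fun i => l i / L)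
    (p := fun i : s => (i : V)) (fun i _ => div_nonneg (hl0 i) hL0.le) hw1 fun i _ => hs i.2
  have h1 := hFA (fun i => J f i) ⟨f, hf, fun _ => le_rfl⟩
  have h2 := hFB (fun _ => D + ε / 2) (fun _ _ => by simp [hε])
  rw [hF] at h1 h2
  rw [← Finset.mul_sum, ← hL] at h2
  have h3 : ∑ i : s, (l i / L) • J f i = (∑ i : s, J f i * l i) / L := by
    rw [Finset.sum_div]
    exact Finset.sum_congr rfl fun i _ => by rw [smul_eq_mul]; ring
  rw [h3] at hjen
  have h4 := (div_le_iff₀ hL0).1 (hjen.trans hJ)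
  linarith

/-- A minimax principle on bounded closed convex subsets of a Hilbert space. -/
theorem exists_forall_le_of_forall_exists_le [CompleteSpace H] {V : Type*} [AddCommGroup V]
    [Module ℝ V] {K : Set H} (hne : K.Nonempty) (hcl : IsClosed K) (hKc : Convex ℝ K) {R : ℝ}
    (hR : ∀ f ∈ K, ‖f‖ ≤ R) {S : Set V} {J : H → V → ℝ}
    (hconv : ∀ φ ∈ S, ConvexOn ℝ K fun f => J f φ)
    (hclosed : ∀ φ ∈ S, ∀ c, IsClosed {f | f ∈ K ∧ J f φ ≤ c})
    (hconc : ∀ f ∈ K, ConcaveOn ℝ S (J f)) {D : ℝ}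
    (h : ∀ φ ∈ S, ∀ ε > 0, ∃ f ∈ K, J f φ ≤ D + ε) : ∃ f ∈ K, ∀ φ ∈ S, J f φ ≤ D := by
  classical
  -- Indices are a finite set of constraints and a tolerance: enlarging the one or lowering the
  -- other shrinks the set, so the family is directed.
  let ι := {s : Finset V // (s : Set V) ⊆ S} × {ε : ℝ // 0 < ε}
  let C : ι → Set H := fun i => K ∩ ⋂ φ ∈ i.1.1, {f | f ∈ K ∧ J f φ ≤ D + i.2.1}
  have hmem : ∀ i f, f ∈ C i ↔ f ∈ K ∧ ∀ φ ∈ i.1.1, J f φ ≤ D + i.2.1 := fun i f => by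
    simp only [C, mem_inter_iff, mem_iInter, mem_ofPred_eq]
    exact ⟨fun h => ⟨h.1, fun φ hφ => (h.2 φ hφ).2⟩, fun h => ⟨h.1, fun φ hφ => ⟨h.1, h.2 φ hφ⟩⟩⟩
  have : Nonempty ι := ⟨⟨⟨∅, by simp⟩, ⟨1, one_pos⟩⟩⟩
  have hdir : Directed (· ⊇ ·) C := by
    rintro ⟨⟨s, hs⟩, ⟨a, ha⟩⟩ ⟨⟨t, ht⟩, ⟨b, hb⟩⟩
    refine ⟨⟨⟨s ∪ t, by simpa using And.intro hs ht⟩, ⟨min a b, lt_min ha hb⟩⟩, ?_, ?_⟩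
    all_goals
      intro f hf
      rw [hmem] at hf ⊢
      refine ⟨hf.1, fun φ hφ => (hf.2 φ ?_).trans ?_⟩
      · simp [show φ ∈ _ from hφ]
      · simp
  obtain ⟨f, hf⟩ := nonempty_iInter_of_directed_convex hdir (fun i => by
      obtain ⟨f, hf, h'⟩ := exists_forall_mem_finset_le hne hconv hconc h i.1.1 i.1.2 i.2.2
      exact ⟨f, (hmem i f).2 ⟨hf, h'⟩⟩)
    (fun i => hcl.inter (isClosed_biInter fun φ hφ => hclosed φ (i.1.2 hφ) _))
    (fun i => hKc.inter (convex_iInter₂ fun φ hφ => (hconv φ (i.1.2 hφ)).convex_le _))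
    (fun i f hf => hR f hf.1)
  rw [mem_iInter] at hf
  refine ⟨f, ((hmem _ f).1 (hf this.some)).1, fun φ hφ => le_of_forall_pos_le_add fun ε hε => ?_⟩
  exact ((hmem _ f).1 (hf ⟨⟨{φ}, by simpa using hφ⟩, ⟨ε, hε⟩⟩)).2 φ (by simp)

end

/-! ### The maximal Hamiltonian along C¹ curves. -/

lemma aestronglyMeasurable_comp_prodMk {E Z : Type*} [TopologicalSpace E] [TopologicalSpace Z]
    {ν : Measure ℝ} {g : ℝ → E} (hg : AEStronglyMeasurable g ν) {F : ℝ × E → Z}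
    (hF : Continuous F) : AEStronglyMeasurable (fun t => F (t, g t)) ν :=
  hF.comp_aestronglyMeasurable
    (AEStronglyMeasurable.prodMk continuous_id.aestronglyMeasurable hg)

section

variable {X : Type*} [Fintype X]

lemma isH1_of_contDiff {φ : ℝ → X → ℝ} (hφ : ContDiff ℝ 1 φ) : IsH1 1 φ (deriv φ) := by
  have hmem : ∀ {g : ℝ → X → ℝ}, Continuous g → MemLp g 2 (volume.restrict (Ioo 0 1)) := by
    intro g hg
    obtain ⟨C, hC⟩ := isCompact_Icc.exists_bound_of_continuousOn (s := Icc (0 : ℝ) 1)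
      hg.continuousOn
    exact MemLp.of_bound hg.aestronglyMeasurable C
      ((ae_restrict_mem measurableSet_Ioo).mono fun t ht => hC t (Ioo_subset_Icc_self ht))
  have hd := hφ.continuous_deriv le_rfl
  refine ⟨hφ.continuous.continuousOn, hmem hφ.continuous, hmem hd, fun x => ?_⟩
  have hdx : ∀ t, HasDerivAt (fun t => φ t x) (deriv φ t x) t := fun t =>
    hasDerivAt_pi.1 (hφ.differentiable one_ne_zero t).hasDerivAt x
  have hcx : Continuous fun t => deriv φ t x := (continuous_apply x).comp hd
  have h := hasWeakDeriv_primitive one_pos (φ 0 x) (hcx.intervalIntegrable 0 1)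
  have e : ∀ t, φ 0 x + ∫ s in (0 : ℝ)..t, deriv φ s x = φ t x := fun t => by
    rw [intervalIntegral.integral_eq_sub_of_hasDerivAt (fun s _ => hdx s)
      (hcx.intervalIntegrable 0 t)]
    ring
  simpa only [e] using h

variable {Λ : ℝ → ℝ → ℝ} {Q : X → X → ℝ}

lemma continuous_ham_curve (hc : Continuous fun p : ℝ × ℝ => Λ p.1 p.2) (Q : X → X → ℝ)
    {φ : ℝ → X → ℝ} (hφ : ContDiff ℝ 1 φ) :
    Continuous fun z : ℝ × (X → ℝ) => ham Λ Q (deriv φ z.1) (φ z.1) z.2 :=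
  (continuous_ham hc Q).comp (f := fun z : ℝ × (X → ℝ) => (deriv φ z.1, φ z.1, z.2))
    (((hφ.continuous_deriv le_rfl).comp continuous_fst).prodMk
      ((hφ.continuous.comp continuous_fst).prodMk continuous_snd))

lemma exists_ham_bound (hc : Continuous fun p : ℝ × ℝ => Λ p.1 p.2) (Q : X → X → ℝ)
    {φ : ℝ → X → ℝ} (hφ : ContDiff ℝ 1 φ) :
    ∃ C, ∀ t ∈ Icc (0 : ℝ) 1, ∀ μ ∈ stdSimplex ℝ X, ‖ham Λ Q (deriv φ t) (φ t) μ‖ ≤ C := by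
  obtain ⟨C, hC⟩ := (isCompact_Icc.prod (isCompact_stdSimplex ℝ X)).exists_bound_of_continuousOn
    (s := Icc (0 : ℝ) 1 ×ˢ stdSimplex ℝ X) (continuous_ham_curve hc Q hφ).continuousOn
  exact ⟨C, fun t ht μ hμ => hC (t, μ) ⟨ht, hμ⟩⟩

lemma aestronglyMeasurable_ham (hc : Continuous fun p : ℝ × ℝ => Λ p.1 p.2) (Q : X → X → ℝ)
    {φ : ℝ → X → ℝ} (hφ : ContDiff ℝ 1 φ) {ν : Measure ℝ} {g : ℝ → X → ℝ}
    (hg : AEStronglyMeasurable g ν) :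
    AEStronglyMeasurable (fun t => ham Λ Q (deriv φ t) (φ t) (g t)) ν := by
  exact aestronglyMeasurable_comp_prodMk hg (F := fun z => ham Λ Q (deriv φ z.1) (φ z.1) z.2)
    (continuous_ham_curve hc Q hφ)

lemma integrable_ham (hc : Continuous fun p : ℝ × ℝ => Λ p.1 p.2) (Q : X → X → ℝ)
    {φ : ℝ → X → ℝ} (hφ : ContDiff ℝ 1 φ) {g : ℝ → X → ℝ}
    (hg : AEStronglyMeasurable g (volume.restrict (Ioo 0 1)))
    (hg' : ∀ᵐ t ∂volume.restrict (Ioo 0 1), g t ∈ stdSimplex ℝ X) :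
    Integrable (fun t => ham Λ Q (deriv φ t) (φ t) (g t)) (volume.restrict (Ioo 0 1)) := by
  obtain ⟨C, hC⟩ := exists_ham_bound hc Q hφ
  refine Integrable.of_bound (aestronglyMeasurable_ham hc Q hφ hg) C ?_
  filter_upwards [hg', ae_restrict_mem measurableSet_Ioo] with t h1 h2
  exact hC t (Ioo_subset_Icc_self h2) _ h1

/-- The maximum of the Hamiltonian over the probability vectors, along a curve. -/
def maxHam (Λ : ℝ → ℝ → ℝ) (Q : X → X → ℝ) (φ : ℝ → X → ℝ) (t : ℝ) : ℝ :=
  sSup ((fun μ => ham Λ Q (deriv φ t) (φ t) μ) '' stdSimplex ℝ X)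

lemma continuous_maxHam (hc : Continuous fun p : ℝ × ℝ => Λ p.1 p.2) (Q : X → X → ℝ)
    {φ : ℝ → X → ℝ} (hφ : ContDiff ℝ 1 φ) : Continuous (maxHam Λ Q φ) :=
  (isCompact_stdSimplex ℝ X).continuous_sSup (continuous_ham_curve hc Q hφ)

lemma continuous_ham_right (hc : Continuous fun p : ℝ × ℝ => Λ p.1 p.2) (Q : X → X → ℝ)
    (p φ : X → ℝ) : Continuous fun μ => ham Λ Q p φ μ :=
  (continuous_ham hc Q).comp (f := fun μ : X → ℝ => (p, φ, μ)) (by fun_prop)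

lemma ham_le_maxHam (hc : Continuous fun p : ℝ × ℝ => Λ p.1 p.2) (Q : X → X → ℝ)
    (φ : ℝ → X → ℝ) (t : ℝ) {μ : X → ℝ} (hμ : μ ∈ stdSimplex ℝ X) :
    ham Λ Q (deriv φ t) (φ t) μ ≤ maxHam Λ Q φ t :=
  le_csSup ((isCompact_stdSimplex ℝ X).image (continuous_ham_right hc Q _ _)).bddAbove
    (mem_image_of_mem _ hμ)

lemma exists_ham_eq_maxHam (hc : Continuous fun p : ℝ × ℝ => Λ p.1 p.2) (Q : X → X → ℝ)
    (hne : (stdSimplex ℝ X).Nonempty) (φ : ℝ → X → ℝ) (t : ℝ) :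
    ∃ μ ∈ stdSimplex ℝ X, ham Λ Q (deriv φ t) (φ t) μ = maxHam Λ Q φ t := by
  obtain ⟨μ, h1, h2⟩ := (isCompact_stdSimplex ℝ X).exists_sSup_image_eq hne
    (continuous_ham_right hc Q (deriv φ t) (φ t)).continuousOn
  exact ⟨μ, h1, h2.symm⟩

/-- Subtracting a function of time turns any `C¹` curve into a Hamilton--Jacobi subsolution. -/
lemma exists_subsolution (hc : Continuous fun p : ℝ × ℝ => Λ p.1 p.2) (Q : X → X → ℝ)
    {φ : ℝ → X → ℝ} (hφ : ContDiff ℝ 1 φ) {μ₀ μ₁ : X → ℝ} (hμ₀ : μ₀ ∈ stdSimplex ℝ X)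
    (hμ₁ : μ₁ ∈ stdSimplex ℝ X) :
    ∃ ψ ∈ HJC1 Λ Q 1, ip (ψ 1) μ₁ - ip (ψ 0) μ₀
      = ip (φ 1) μ₁ - ip (φ 0) μ₀ - ∫ t in Ioo 0 1, maxHam Λ Q φ t := by
  have hm := continuous_maxHam hc Q hφ
  have hip : ∀ (p : X → ℝ) (c : ℝ), ∀ μ ∈ stdSimplex ℝ X,
      ip (fun x => p x - c) μ = ip p μ - c := fun p c μ hμ => by
    simp only [ip, sub_mul, Finset.sum_sub_distrib, ← Finset.mul_sum, hμ.2, mul_one]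
  have hd : ∀ t, HasDerivAt (fun t => ∫ s in (0 : ℝ)..t, maxHam Λ Q φ s) (maxHam Λ Q φ t) t :=
    fun t => intervalIntegral.integral_hasDerivAt_right (hm.intervalIntegrable _ _)
      hm.aestronglyMeasurable.stronglyMeasurableAtFilter hm.continuousAt
  have hψd : ∀ t, HasDerivAt (fun t x => φ t x - ∫ s in (0 : ℝ)..t, maxHam Λ Q φ s)
      (fun x => deriv φ t x - maxHam Λ Q φ t) t := fun t =>
    hasDerivAt_pi.2 fun x =>
      (hasDerivAt_pi.1 (hφ.differentiable one_ne_zero t).hasDerivAt x).sub (hd t)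
  have hderiv : deriv (fun t x => φ t x - ∫ s in (0 : ℝ)..t, maxHam Λ Q φ s)
      = fun t x => deriv φ t x - maxHam Λ Q φ t := funext fun t => (hψd t).deriv
  have hψ : ContDiff ℝ 1 (fun t x => φ t x - ∫ s in (0 : ℝ)..t, maxHam Λ Q φ s) := by
    rw [contDiff_one_iff_deriv, hderiv]
    refine ⟨fun t => (hψd t).differentiableAt, continuous_pi fun x => ?_⟩
    exact ((continuous_apply x).comp (hφ.continuous_deriv le_rfl)).sub hm
  -- The witness is φ minus the primitive of `maxHam`. The gradient ignores functions of time alone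
  -- and μ has mass one, so the Hamiltonian drops by exactly `maxHam`.
  refine ⟨_, ⟨⟨_, isH1_of_contDiff hψ, .of_forall fun t μ hμ => ?_⟩, hψ.contDiffOn⟩, ?_⟩
  · have h := ham_le_maxHam hc Q φ t hμ
    rw [hderiv, hip _ _ μ hμ]
    have e : grad (fun x => φ t x - ∫ s in (0 : ℝ)..t, maxHam Λ Q φ s) = grad (φ t) := by
      funext x y; simp [grad]
    rw [e]
    unfold ham at h
    linarith
  · rw [hip _ _ μ₁ hμ₁, hip _ _ μ₀ hμ₀, setIntegral_Ioo_eq_intervalIntegral zero_le_one]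
    simp only [intervalIntegral.integral_same]
    ring

/-- The maximum over the simplex in the integral of the Hamiltonian is almost attained by a
step function. -/
lemma exists_almost_maximal_curve (hc : Continuous fun p : ℝ × ℝ => Λ p.1 p.2) (Q : X → X → ℝ)
    (hne : (stdSimplex ℝ X).Nonempty) {φ : ℝ → X → ℝ} (hφ : ContDiff ℝ 1 φ) {ε : ℝ} (hε : 0 < ε) :
    ∃ g : ℝ → X → ℝ, Measurable g ∧ (∀ t, g t ∈ stdSimplex ℝ X) ∧
      ∀ t ∈ Ioo (0 : ℝ) 1, maxHam Λ Q φ t - ε ≤ ham Λ Q (deriv φ t) (φ t) (g t) := by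
  have huc := (isCompact_Icc.prod (isCompact_stdSimplex ℝ X)).uniformContinuousOn_of_continuous
    (s := Icc (0 : ℝ) 1 ×ˢ stdSimplex ℝ X) (continuous_ham_curve hc Q hφ).continuousOn
  obtain ⟨δ, hδ, hδ'⟩ := Metric.uniformContinuousOn_iff.1 huc (ε / 2) (half_pos hε)
  obtain ⟨N, hN⟩ := exists_nat_one_div_lt hδ
  choose m hm1 hm2 using exists_ham_eq_maxHam hc Q hne φ
  set M : ℝ := (N : ℝ) + 1 with hM
  have hM0 : 0 < M := by positivity
  -- Maximisers are frozen on intervals of length 1 / M; factoring through the integers makes the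
  -- curve measurable without a measurable selection. Uniform continuity costs ε/2 at each of the
  -- two maximisers.
  refine ⟨fun t => m ((⌊M * t⌋ : ℝ) / M), ?_, fun t => hm1 _, fun t ht => ?_⟩
  · exact (measurable_of_countable fun n : ℤ => m ((n : ℝ) / M)).comp
      (Int.measurable_floor.comp (measurable_const_mul M))
  · set s := (⌊M * t⌋ : ℝ) / M with hs
    have h1 : (⌊M * t⌋ : ℝ) ≤ M * t := Int.floor_le _
    have h2 : M * t < ⌊M * t⌋ + 1 := Int.lt_floor_add_one _
    have h3 : (0 : ℝ) ≤ ⌊M * t⌋ := by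
      exact_mod_cast Int.floor_nonneg.2 (mul_nonneg hM0.le ht.1.le)
    have hs0 : 0 ≤ s := div_nonneg h3 hM0.le
    have hst : s ≤ t := by rw [hs, div_le_iff₀ hM0]; linarith
    have hts : t - s < δ := by
      refine lt_of_le_of_lt ?_ hN
      have : t - s = (M * t - ⌊M * t⌋) / M := by rw [hs]; field_simp
      rw [this]
      exact div_le_div_of_nonneg_right (by linarith) hM0.le
    have hclose : ∀ μ ∈ stdSimplex ℝ X,
        |ham Λ Q (deriv φ t) (φ t) μ - ham Λ Q (deriv φ s) (φ s) μ| < ε / 2 := fun μ hμ => by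
      have := hδ' (t, μ) ⟨Ioo_subset_Icc_self ht, hμ⟩ (s, μ) ⟨⟨hs0, hst.trans ht.2.le⟩, hμ⟩ (by
        rw [Prod.dist_eq, dist_self, Real.dist_eq, abs_of_nonneg (by linarith)]
        exact max_lt hts hδ)
      rwa [Real.dist_eq] at this
    have a1 := abs_lt.1 (hclose (m s) (hm1 s))
    have a2 := abs_lt.1 (hclose (m t) (hm1 t))
    have a3 := ham_le_maxHam hc Q φ s (hm1 t)
    have a4 := hm2 s
    have a5 := hm2 t
    linarith [a1.1, a2.2]

/-! ### The Lagrangian on the convex set of L² curves in the simplex. -/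

/-- The curves in the simplex, up to equality almost everywhere on `(0,1)`. -/
def simplexCurves (X : Type*) [Fintype X] :
    Set (Lp (EuclideanSpace ℝ X) 2 (volume.restrict (Ioo (0 : ℝ) 1))) :=
  {f | ∀ᵐ t ∂volume.restrict (Ioo (0 : ℝ) 1), (f t).ofLp ∈ stdSimplex ℝ X}

/-- The Lagrangian of the dynamical transport problem. -/
def lagrangian (Λ : ℝ → ℝ → ℝ) (Q : X → X → ℝ) (μ₀ μ₁ : X → ℝ) (g φ : ℝ → X → ℝ) : ℝ :=
  ip (φ 1) μ₁ - ip (φ 0) μ₀ - ∫ t in Ioo 0 1, ham Λ Q (deriv φ t) (φ t) (g t)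

lemma norm_le_one_of_mem_stdSimplex {v : EuclideanSpace ℝ X} (hv : v.ofLp ∈ stdSimplex ℝ X) :
    ‖v‖ ≤ 1 := by
  rw [EuclideanSpace.norm_eq, Real.sqrt_le_one, ← hv.2]
  refine Finset.sum_le_sum fun x _ => ?_
  have h1 : v.ofLp x ≤ 1 := hv.2 ▸ Finset.single_le_sum (fun y _ => hv.1 y) (Finset.mem_univ x)
  rw [Real.norm_eq_abs, sq_abs]
  nlinarith [hv.1 x]

lemma aestronglyMeasurable_ofLp
    (f : Lp (EuclideanSpace ℝ X) 2 (volume.restrict (Ioo (0 : ℝ) 1))) :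
    AEStronglyMeasurable (fun t => (f t).ofLp) (volume.restrict (Ioo (0 : ℝ) 1)) :=
  (PiLp.continuous_ofLp 2 _).comp_aestronglyMeasurable (Lp.aestronglyMeasurable f)

lemma exists_simplexCurve {g : ℝ → X → ℝ} (hg : Measurable g) (hg' : ∀ t, g t ∈ stdSimplex ℝ X) :
    ∃ f ∈ simplexCurves X, ∀ᵐ t ∂volume.restrict (Ioo (0 : ℝ) 1), (f t).ofLp = g t := by
  have hm : MemLp (fun t => WithLp.toLp 2 (g t) : ℝ → EuclideanSpace ℝ X) 2
      (volume.restrict (Ioo (0 : ℝ) 1)) := by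
    refine MemLp.of_bound ?_ 1 (.of_forall fun t => norm_le_one_of_mem_stdSimplex (hg' t))
    exact (PiLp.continuous_toLp 2 _).comp_aestronglyMeasurable hg.aestronglyMeasurable
  have h : ∀ᵐ t ∂volume.restrict (Ioo (0 : ℝ) 1), (hm.toLp _ t).ofLp = g t :=
    hm.coeFn_toLp.mono fun t ht => by rw [ht]
  exact ⟨hm.toLp _, h.mono fun t ht => by rw [ht]; exact hg' t, h⟩

end

section

variable {X : Type*} [Fintype X] {Λ : ℝ → ℝ → ℝ} {Q : X → X → ℝ}

lemma simplexCurves_norm_le {f : Lp (EuclideanSpace ℝ X) 2 (volume.restrict (Ioo (0 : ℝ) 1))}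
    (hf : f ∈ simplexCurves X) : ‖f‖ ≤ 1 := by
  have hf' : ∀ᵐ t ∂volume.restrict (Ioo (0 : ℝ) 1), (f t).ofLp ∈ stdSimplex ℝ X := hf
  have := Lp.norm_le_of_ae_bound zero_le_one
    (hf'.mono fun t ht => norm_le_one_of_mem_stdSimplex ht)
  simpa [measureUnivNNReal] using this

/-- L² limits become pointwise limits along a subsequence. This gives closedness of the simplex
constraint and, by dominated convergence, of the sublevel sets of the Lagrangian. -/
lemma exists_ae_tendsto_subseq
    {f : ℕ → Lp (EuclideanSpace ℝ X) 2 (volume.restrict (Ioo (0 : ℝ) 1))}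
    {g : Lp (EuclideanSpace ℝ X) 2 (volume.restrict (Ioo (0 : ℝ) 1))}
    (h : Filter.Tendsto f Filter.atTop (nhds g)) :
    ∃ ns : ℕ → ℕ, ∀ᵐ t ∂volume.restrict (Ioo (0 : ℝ) 1),
      Filter.Tendsto (fun i => (f (ns i) t).ofLp) Filter.atTop (nhds (g t).ofLp) := by
  obtain ⟨ns, -, h2⟩ := (tendstoInMeasure_of_tendsto_Lp h).exists_seq_tendsto_ae
  exact ⟨ns, h2.mono fun t ht => ((PiLp.continuous_ofLp 2 _).tendsto _).comp ht⟩

lemma isClosed_simplexCurves : IsClosed (simplexCurves X) := by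
  refine IsSeqClosed.isClosed fun f g hf hg => ?_
  obtain ⟨ns, hns⟩ := exists_ae_tendsto_subseq hg
  have hf' : ∀ᵐ t ∂volume.restrict (Ioo (0 : ℝ) 1), ∀ n, (f n t).ofLp ∈ stdSimplex ℝ X :=
    ae_all_iff.2 hf
  filter_upwards [hns, hf'] with t h1 h2
  exact (isClosed_stdSimplex ℝ X).mem_of_tendsto h1 (.of_forall fun i => h2 _)

lemma convex_simplexCurves : Convex ℝ (simplexCurves X) := by
  intro f hf g hg a b ha hb hab
  have hf' : ∀ᵐ t ∂volume.restrict (Ioo (0 : ℝ) 1), (f t).ofLp ∈ stdSimplex ℝ X := hf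
  have hg' : ∀ᵐ t ∂volume.restrict (Ioo (0 : ℝ) 1), (g t).ofLp ∈ stdSimplex ℝ X := hg
  filter_upwards [hf', hg', Lp.coeFn_add (a • f) (b • g), Lp.coeFn_smul a f, Lp.coeFn_smul b g]
    with t h1 h2 h3 h4 h5
  rw [h3, Pi.add_apply, h4, h5]
  exact convex_stdSimplex ℝ X h1 h2 ha hb hab

lemma integrable_ham_simplexCurves (hc : Continuous fun p : ℝ × ℝ => Λ p.1 p.2) (Q : X → X → ℝ)
    {φ : ℝ → X → ℝ} (hφ : ContDiff ℝ 1 φ)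
    {f : Lp (EuclideanSpace ℝ X) 2 (volume.restrict (Ioo (0 : ℝ) 1))} (hf : f ∈ simplexCurves X) :
    Integrable (fun t => ham Λ Q (deriv φ t) (φ t) (f t).ofLp) (volume.restrict (Ioo 0 1)) :=
  integrable_ham hc Q hφ (aestronglyMeasurable_ofLp f) hf

lemma convexOn_lagrangian (hΛ : IsAdmissibleMean Λ) (hc : Continuous fun p : ℝ × ℝ => Λ p.1 p.2)
    (hQ : ∀ x y, 0 ≤ Q x y) (μ₀ μ₁ : X → ℝ) {φ : ℝ → X → ℝ} (hφ : ContDiff ℝ 1 φ) :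
    ConvexOn ℝ (simplexCurves X)
      fun f => lagrangian Λ Q μ₀ μ₁ (fun t => (f t).ofLp) φ := by
  refine ⟨convex_simplexCurves, fun f hf g hg a b ha hb hab => ?_⟩
  have hf' : ∀ᵐ t ∂volume.restrict (Ioo (0 : ℝ) 1), (f t).ofLp ∈ stdSimplex ℝ X := hf
  have hg' : ∀ᵐ t ∂volume.restrict (Ioo (0 : ℝ) 1), (g t).ofLp ∈ stdSimplex ℝ X := hg
  have i1 := integrable_ham_simplexCurves hc Q hφ hf
  have i2 := integrable_ham_simplexCurves hc Q hφ hg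
  have i3 := integrable_ham_simplexCurves hc Q hφ (convex_simplexCurves hf hg ha hb hab)
  have h := integral_mono_ae ((i1.const_mul a).add (i2.const_mul b)) i3 (by
    filter_upwards [hf', hg', Lp.coeFn_add (a • f) (b • g), Lp.coeFn_smul a f, Lp.coeFn_smul b g]
      with t h1 h2 h3 h4 h5
    rw [h3, Pi.add_apply (↑↑(a • f)), h4, h5]
    exact ham_concave hΛ hQ _ _ h1.1 h2.1 ha hb)
  have h0 : ∫ t in Ioo (0 : ℝ) 1, ((fun t => a * ham Λ Q (deriv φ t) (φ t) (f t).ofLp)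
        + fun t => b * ham Λ Q (deriv φ t) (φ t) (g t).ofLp) t
      = a * (∫ t in Ioo (0 : ℝ) 1, ham Λ Q (deriv φ t) (φ t) (f t).ofLp)
        + b * ∫ t in Ioo (0 : ℝ) 1, ham Λ Q (deriv φ t) (φ t) (g t).ofLp := by
    rw [integral_add' (i1.const_mul a) (i2.const_mul b), integral_const_mul, integral_const_mul]
  rw [h0] at h
  simp only [lagrangian, smul_eq_mul]
  obtain rfl : b = 1 - a := by linarith
  linarith

lemma concaveOn_lagrangian (hΛ : IsAdmissibleMean Λ) (hc : Continuous fun p : ℝ × ℝ => Λ p.1 p.2)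
    (hQ : ∀ x y, 0 ≤ Q x y) (μ₀ μ₁ : X → ℝ) {g : ℝ → X → ℝ}
    (hg : AEStronglyMeasurable g (volume.restrict (Ioo 0 1)))
    (hg' : ∀ᵐ t ∂volume.restrict (Ioo 0 1), g t ∈ stdSimplex ℝ X) :
    ConcaveOn ℝ {φ : ℝ → X → ℝ | ContDiff ℝ 1 φ} (lagrangian Λ Q μ₀ μ₁ g) := by
  have hconv : Convex ℝ {φ : ℝ → X → ℝ | ContDiff ℝ 1 φ} := fun φ hφ ψ hψ a b _ _ _ =>
    (ContDiff.const_smul a (show ContDiff ℝ 1 φ from hφ)).add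
      (ContDiff.const_smul b (show ContDiff ℝ 1 ψ from hψ))
  refine ⟨hconv, fun φ hφ ψ hψ a b ha hb hab => ?_⟩
  have hφ1 : ContDiff ℝ 1 φ := hφ
  have hψ1 : ContDiff ℝ 1 ψ := hψ
  have i1 := integrable_ham hc Q hφ1 hg hg'
  have i2 := integrable_ham hc Q hψ1 hg hg'
  have i3 := integrable_ham hc Q (hconv hφ hψ ha hb hab) hg hg'
  have h := integral_mono_ae i3 ((i1.const_mul a).add (i2.const_mul b)) (by
    filter_upwards [hg'] with t ht
    have : deriv (a • φ + b • ψ) t = a • deriv φ t + b • deriv ψ t := by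
      have d1 := (hφ1.differentiable one_ne_zero t).hasDerivAt
      have d2 := (hψ1.differentiable one_ne_zero t).hasDerivAt
      exact ((d1.const_smul a).add (d2.const_smul b)).deriv
    rw [this]
    exact ham_convex hΛ hQ _ _ _ _ ht.1 ha hb hab)
  have h0 : ∫ t in Ioo (0 : ℝ) 1, ((fun t => a * ham Λ Q (deriv φ t) (φ t) (g t))
        + fun t => b * ham Λ Q (deriv ψ t) (ψ t) (g t)) t
      = a * (∫ t in Ioo (0 : ℝ) 1, ham Λ Q (deriv φ t) (φ t) (g t))
        + b * ∫ t in Ioo (0 : ℝ) 1, ham Λ Q (deriv ψ t) (ψ t) (g t) := by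
    rw [integral_add' (i1.const_mul a) (i2.const_mul b), integral_const_mul, integral_const_mul]
  rw [h0] at h
  simp only [lagrangian, smul_eq_mul]
  rw [Pi.add_apply, Pi.add_apply, Pi.smul_apply, Pi.smul_apply, Pi.smul_apply, Pi.smul_apply,
    ip_smul_add, ip_smul_add]
  linarith

lemma isClosed_sublevel_lagrangian (hc : Continuous fun p : ℝ × ℝ => Λ p.1 p.2) (Q : X → X → ℝ)
    (μ₀ μ₁ : X → ℝ) {φ : ℝ → X → ℝ} (hφ : ContDiff ℝ 1 φ) (c : ℝ) :
    IsClosed {f | f ∈ simplexCurves X ∧ lagrangian Λ Q μ₀ μ₁ (fun t => (f t).ofLp) φ ≤ c} := by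
  refine IsSeqClosed.isClosed fun f g hf hg => ?_
  have hgK : g ∈ simplexCurves X :=
    isClosed_simplexCurves.isSeqClosed (fun n => (hf n).1) hg
  refine ⟨hgK, ?_⟩
  obtain ⟨ns, hns⟩ := exists_ae_tendsto_subseq hg
  obtain ⟨C, hC⟩ := exists_ham_bound hc Q hφ
  have hlim := tendsto_integral_of_dominated_convergence (fun _ => C)
    (F := fun n t => ham Λ Q (deriv φ t) (φ t) (f (ns n) t).ofLp)
    (f := fun t => ham Λ Q (deriv φ t) (φ t) (g t).ofLp)
    (μ := volume.restrict (Ioo (0 : ℝ) 1))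
    (fun n => aestronglyMeasurable_ham hc Q hφ (aestronglyMeasurable_ofLp _))
    (integrable_const C)
    (fun n => by
      have hn : ∀ᵐ t ∂volume.restrict (Ioo (0 : ℝ) 1), (f (ns n) t).ofLp ∈ stdSimplex ℝ X :=
        (hf (ns n)).1
      filter_upwards [hn, ae_restrict_mem measurableSet_Ioo] with t h1 h2
      exact hC t (Ioo_subset_Icc_self h2) _ h1)
    (hns.mono fun t ht => ((continuous_ham_right hc Q _ _).tendsto _).comp ht)
  exact le_of_tendsto (hlim.const_sub (ip (φ 1) μ₁ - ip (φ 0) μ₀))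
    (.of_forall fun n => (hf (ns n)).2)

/-- If all values of the dual problem are at most `D`, then there is a curve in the simplex whose
Lagrangian is at most `D`. -/
theorem exists_curve_lagrangian_le (hΛ : IsAdmissibleMean Λ)
    (hc : Continuous fun p : ℝ × ℝ => Λ p.1 p.2) (hQ : ∀ x y, 0 ≤ Q x y) {μ₀ μ₁ : X → ℝ}
    (hμ₀ : μ₀ ∈ stdSimplex ℝ X) (hμ₁ : μ₁ ∈ stdSimplex ℝ X) {D : ℝ}
    (hD : ∀ φ ∈ HJC1 Λ Q 1, ip (φ 1) μ₁ - ip (φ 0) μ₀ ≤ D) :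
    ∃ g : ℝ → X → ℝ, AEStronglyMeasurable g (volume.restrict (Ioo 0 1)) ∧
      (∀ᵐ t ∂volume.restrict (Ioo (0 : ℝ) 1), g t ∈ stdSimplex ℝ X) ∧
      ∀ φ, ContDiff ℝ 1 φ → lagrangian Λ Q μ₀ μ₁ g φ ≤ D := by
  obtain ⟨f₀, hf₀, -⟩ := exists_simplexCurve (X := X) (g := fun _ => μ₀) measurable_const
    fun _ => hμ₀
  obtain ⟨f, hf, hfD⟩ := exists_forall_le_of_forall_exists_le ⟨f₀, hf₀⟩ isClosed_simplexCurves
    convex_simplexCurves (fun f hf => simplexCurves_norm_le hf)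
    (S := {φ : ℝ → X → ℝ | ContDiff ℝ 1 φ})
    (J := fun f φ => lagrangian Λ Q μ₀ μ₁ (fun t => (f t).ofLp) φ) (D := D)
    (fun φ hφ => convexOn_lagrangian hΛ hc hQ μ₀ μ₁ hφ)
    (fun φ hφ c => isClosed_sublevel_lagrangian hc Q μ₀ μ₁ hφ c)
    (fun f hf => concaveOn_lagrangian hΛ hc hQ μ₀ μ₁ (aestronglyMeasurable_ofLp f) hf)
    -- An almost maximal curve brings the Lagrangian to within ε of the value of a C¹ subsolution,
    -- which is at most `D`.
    (fun φ hφ ε hε => by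
      have hφ1 : ContDiff ℝ 1 φ := hφ
      obtain ⟨g, hg1, hg2, hg3⟩ := exists_almost_maximal_curve hc Q ⟨μ₀, hμ₀⟩ hφ1 hε
      obtain ⟨f, hf, hfg⟩ := exists_simplexCurve hg1 hg2
      refine ⟨f, hf, ?_⟩
      obtain ⟨ψ, hψ, hval⟩ := exists_subsolution hc Q hφ1 hμ₀ hμ₁
      have h1 := hD ψ hψ
      have hmi : Integrable (maxHam Λ Q φ) (volume.restrict (Ioo (0 : ℝ) 1)) :=
        ((continuous_maxHam hc Q hφ1).continuousOn.integrableOn_Icc).mono_set Ioo_subset_Icc_self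
      have h2 := integral_mono_ae (hmi.sub (integrable_const ε))
        (integrable_ham_simplexCurves hc Q hφ1 hf) (by
          filter_upwards [hfg, ae_restrict_mem measurableSet_Ioo] with t e1 e2
          rw [e1]
          exact hg3 t e2)
      have h3 : ∫ t in Ioo (0 : ℝ) 1, (maxHam Λ Q φ - fun _ : ℝ => ε) t
          = (∫ t in Ioo (0 : ℝ) 1, maxHam Λ Q φ t) - ε := by
        rw [integral_sub' hmi (integrable_const ε)]
        simp
      rw [h3] at h2
      simp only [lagrangian]
      linarith)
  exact ⟨_, aestronglyMeasurable_ofLp f, hf, hfD⟩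

end

/-! ### Riesz representation and the quadratic form of the Lagrangian. -/

/-- Riesz representation for a functional that is dominated by a quadratic form. -/
theorem exists_inner_eq_of_sub_half_norm_sq_le {V H : Type*} [AddCommGroup V] [Module ℝ V]
    [NormedAddCommGroup H] [InnerProductSpace ℝ H] [CompleteSpace H] (l : V →ₗ[ℝ] ℝ)
    (G : V →ₗ[ℝ] H) {D : ℝ} (h : ∀ v, l v - (1 / 2) * ‖G v‖ ^ 2 ≤ D) :
    ∃ ψ : H, ‖ψ‖ ^ 2 ≤ 2 * D ∧ ∀ v, l v = inner ℝ ψ (G v) := by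
  have hD : 0 ≤ D := by simpa using h 0
  have hsq : ∀ v, l v ^ 2 ≤ 2 * D * ‖G v‖ ^ 2 := fun v => by
    -- Replacing `v` by `c • v` gives a quadratic polynomial in `c` that is nowhere negative.
    have := discrim_le_zero (a := (1 / 2) * ‖G v‖ ^ 2) (b := -l v) (c := D) fun c => by
      have := h (c • v)
      rw [map_smul, map_smul, norm_smul, mul_pow, Real.norm_eq_abs, sq_abs, smul_eq_mul] at this
      nlinarith
    rw [discrim] at this
    linarith
  have hb : ∀ v, ‖l v‖ ≤ √(2 * D) * ‖G v‖ := fun v => by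
    rw [Real.norm_eq_abs]
    refine abs_le_of_sq_le_sq ?_ (by positivity)
    rw [mul_pow, Real.sq_sqrt (by positivity)]
    exact hsq v
  have hker : LinearMap.ker G ≤ LinearMap.ker l := fun v hv => by
    have := hb v
    rw [LinearMap.mem_ker.1 hv, norm_zero, mul_zero] at this
    exact norm_le_zero_iff.1 this
  -- Vanishing on the kernel of `G`, `l` descends to a bounded functional on the range, which
  -- Hahn–Banach extends to `H` with the same norm.
  let f : LinearMap.range G →ₗ[ℝ] ℝ :=
    (LinearMap.ker G).liftQ l hker ∘ₗ G.quotKerEquivRange.symm.toLinearMap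
  have hf : ∀ v, f ⟨G v, LinearMap.mem_range_self G v⟩ = l v := fun v => by
    simp only [f, LinearMap.comp_apply, LinearEquiv.coe_coe,
      LinearMap.quotKerEquivRange_symm_apply_image, Submodule.mkQ_apply, Submodule.liftQ_apply]
  let fc : StrongDual ℝ (LinearMap.range G) := f.mkContinuous (√(2 * D)) (by
    rintro ⟨_, v, rfl⟩
    rw [hf v]
    exact hb v)
  obtain ⟨F, hF1, hF2⟩ := exists_extension_norm_eq (LinearMap.range G) fc
  refine ⟨(InnerProductSpace.toDual ℝ H).symm F, ?_, fun v => ?_⟩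
  · rw [LinearIsometryEquiv.norm_map, hF2]
    have h1 : ‖fc‖ ≤ √(2 * D) := LinearMap.mkContinuous_norm_le _ (Real.sqrt_nonneg _) _
    have h2 : √(2 * D) ^ 2 = 2 * D := Real.sq_sqrt (by positivity)
    have h3 : 0 ≤ ‖fc‖ := norm_nonneg fc
    nlinarith
  · rw [InnerProductSpace.toDual_symm_apply]
    have := hF1 ⟨G v, LinearMap.mem_range_self G v⟩
    rw [this]
    exact (hf v).symm

section

variable {X : Type*} [Fintype X] {Λ : ℝ → ℝ → ℝ} {Q : X → X → ℝ}

lemma memLp_comp_curve {F : ℝ × (X → ℝ) → ℝ} (hF : Continuous F) {g : ℝ → X → ℝ}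
    (hg : AEStronglyMeasurable g (volume.restrict (Ioo (0 : ℝ) 1)))
    (hg' : ∀ᵐ t ∂volume.restrict (Ioo (0 : ℝ) 1), g t ∈ stdSimplex ℝ X) (p : ℝ≥0∞) :
    MemLp (fun t => F (t, g t)) p (volume.restrict (Ioo (0 : ℝ) 1)) := by
  obtain ⟨C, hC⟩ := (isCompact_Icc.prod (isCompact_stdSimplex ℝ X)).exists_bound_of_continuousOn
    (s := Icc (0 : ℝ) 1 ×ˢ stdSimplex ℝ X) hF.continuousOn
  refine MemLp.of_bound (aestronglyMeasurable_comp_prodMk hg hF) C ?_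
  filter_upwards [hg', ae_restrict_mem measurableSet_Ioo] with t h1 h2
  exact hC (t, g t) ⟨Ioo_subset_Icc_self h2, h1⟩

/-- The space of continuously differentiable curves. -/
def contDiffCurves (X : Type*) [Fintype X] : Submodule ℝ (ℝ → X → ℝ) where
  carrier := {φ | ContDiff ℝ 1 φ}
  add_mem' {φ ψ} h1 h2 := by
    have h1' : ContDiff ℝ 1 φ := h1
    have h2' : ContDiff ℝ 1 ψ := h2
    exact h1'.add h2'
  zero_mem' := by
    have h : ContDiff ℝ 1 (fun _ : ℝ => (0 : X → ℝ)) := contDiff_const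
    exact h
  smul_mem' c φ h := by
    have h' : ContDiff ℝ 1 φ := h
    exact h'.const_smul c

lemma contDiff_coe (φ : contDiffCurves X) : ContDiff ℝ 1 (φ : ℝ → X → ℝ) := φ.2

lemma deriv_add_curve (φ ψ : contDiffCurves X) (t : ℝ) :
    deriv ((φ + ψ : contDiffCurves X) : ℝ → X → ℝ) t
      = deriv (φ : ℝ → X → ℝ) t + deriv (ψ : ℝ → X → ℝ) t :=
  (((contDiff_coe φ).differentiable one_ne_zero t).hasDerivAt.add
    ((contDiff_coe ψ).differentiable one_ne_zero t).hasDerivAt).deriv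

lemma deriv_smul_curve (c : ℝ) (φ : contDiffCurves X) (t : ℝ) :
    deriv ((c • φ : contDiffCurves X) : ℝ → X → ℝ) t = c • deriv (φ : ℝ → X → ℝ) t :=
  (((contDiff_coe φ).differentiable one_ne_zero t).hasDerivAt.const_smul c).deriv

lemma ip_add_left (p q μ : X → ℝ) : ip (p + q) μ = ip p μ + ip q μ := by
  simp only [ip, Pi.add_apply, add_mul, Finset.sum_add_distrib]

lemma ip_smul_left (c : ℝ) (p μ : X → ℝ) : ip (c • p) μ = c * ip p μ := by
  simp only [ip, Pi.smul_apply, smul_eq_mul, Finset.mul_sum, mul_assoc]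

lemma integrable_ip_deriv {φ : ℝ → X → ℝ} (hφ : ContDiff ℝ 1 φ) {g : ℝ → X → ℝ}
    (hg : AEStronglyMeasurable g (volume.restrict (Ioo (0 : ℝ) 1)))
    (hg' : ∀ᵐ t ∂volume.restrict (Ioo (0 : ℝ) 1), g t ∈ stdSimplex ℝ X) :
    Integrable (fun t => ip (deriv φ t) (g t)) (volume.restrict (Ioo (0 : ℝ) 1)) := by
  have hd := hφ.continuous_deriv le_rfl
  have hF : Continuous fun z : ℝ × (X → ℝ) => ip (deriv φ z.1) z.2 := by
    unfold ip
    fun_prop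
  exact memLp_one_iff_integrable.1 (memLp_comp_curve hF hg hg' 1)

/-- The linear part of the Lagrangian. -/
def lagrangianLinear (μ₀ μ₁ : X → ℝ) {g : ℝ → X → ℝ}
    (hg : AEStronglyMeasurable g (volume.restrict (Ioo (0 : ℝ) 1)))
    (hg' : ∀ᵐ t ∂volume.restrict (Ioo (0 : ℝ) 1), g t ∈ stdSimplex ℝ X) :
    contDiffCurves X →ₗ[ℝ] ℝ where
  toFun φ := ip (φ.1 1) μ₁ - ip (φ.1 0) μ₀ - ∫ t in Ioo (0 : ℝ) 1, ip (deriv φ.1 t) (g t)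
  map_add' φ ψ := by
    have h : ∫ t in Ioo (0 : ℝ) 1, ip (deriv (φ + ψ).1 t) (g t)
        = (∫ t in Ioo (0 : ℝ) 1, ip (deriv φ.1 t) (g t))
          + ∫ t in Ioo (0 : ℝ) 1, ip (deriv ψ.1 t) (g t) := by
      rw [← integral_add (integrable_ip_deriv φ.2 hg hg') (integrable_ip_deriv ψ.2 hg hg')]
      simp only [deriv_add_curve, ip_add_left]
    have e : ∀ t, (φ + ψ).1 t = φ.1 t + ψ.1 t := fun _ => rfl
    rw [h, e, e, ip_add_left, ip_add_left]
    ring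
  map_smul' c φ := by
    have h : ∫ t in Ioo (0 : ℝ) 1, ip (deriv (c • φ).1 t) (g t)
        = c * ∫ t in Ioo (0 : ℝ) 1, ip (deriv φ.1 t) (g t) := by
      rw [← integral_const_mul]
      simp only [deriv_smul_curve, ip_smul_left]
    have e : ∀ t, (c • φ).1 t = c • φ.1 t := fun _ => rfl
    rw [h, e, e, ip_smul_left, ip_smul_left, RingHom.id_apply, smul_eq_mul]
    ring

/-- The weight √(ĝ/2) makes the squared Euclidean norm over pairs equal to ½ ∑ (∇φ)² ĝ = ‖∇φ‖²_g.
Continuity on the compact simplex provides the integrability. -/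
lemma memLp_weightedGrad (hc : Continuous fun p : ℝ × ℝ => Λ p.1 p.2) (Q : X → X → ℝ)
    {φ : ℝ → X → ℝ} (hφ : Continuous φ) {g : ℝ → X → ℝ}
    (hg : AEStronglyMeasurable g (volume.restrict (Ioo (0 : ℝ) 1)))
    (hg' : ∀ᵐ t ∂volume.restrict (Ioo (0 : ℝ) 1), g t ∈ stdSimplex ℝ X) :
    MemLp (fun t => WithLp.toLp 2 (fun e : X × X =>
        √(edgeWeight Λ Q (g t) e.1 e.2 / 2) * grad (φ t) e.1 e.2) : ℝ → EuclideanSpace ℝ (X × X))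
      2 (volume.restrict (Ioo (0 : ℝ) 1)) := by
  refine MemLp.of_eval_piLp fun e => ?_
  have h := continuous_edgeWeight hc Q e.1 e.2
  have hF : Continuous fun z : ℝ × (X → ℝ) =>
      √(edgeWeight Λ Q z.2 e.1 e.2 / 2) * grad (φ z.1) e.1 e.2 := by
    have h' : Continuous fun z : ℝ × (X → ℝ) => edgeWeight Λ Q z.2 e.1 e.2 :=
      h.comp continuous_snd
    unfold grad
    fun_prop
  exact memLp_comp_curve hF hg hg' 2

/-- The gradient of a curve, weighted so that its `L²` norm is the norm of the Lagrangian. -/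
def weightedGrad (hc : Continuous fun p : ℝ × ℝ => Λ p.1 p.2) (Q : X → X → ℝ) {g : ℝ → X → ℝ}
    (hg : AEStronglyMeasurable g (volume.restrict (Ioo (0 : ℝ) 1)))
    (hg' : ∀ᵐ t ∂volume.restrict (Ioo (0 : ℝ) 1), g t ∈ stdSimplex ℝ X) :
    contDiffCurves X →ₗ[ℝ] Lp (EuclideanSpace ℝ (X × X)) 2 (volume.restrict (Ioo (0 : ℝ) 1)) where
  toFun φ := (memLp_weightedGrad hc Q (contDiff_coe φ).continuous hg hg').toLp _
  map_add' φ ψ := by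
    rw [← MemLp.toLp_add]
    congr 1
    funext t
    ext e
    have e' : (φ + ψ).1 t = φ.1 t + ψ.1 t := rfl
    simp [grad]
    ring
  map_smul' c φ := by
    rw [RingHom.id_apply, ← MemLp.toLp_const_smul]
    congr 1
    funext t
    ext e
    simp [grad]
    ring

lemma coeFn_weightedGrad (hc : Continuous fun p : ℝ × ℝ => Λ p.1 p.2) (Q : X → X → ℝ)
    {g : ℝ → X → ℝ} (hg : AEStronglyMeasurable g (volume.restrict (Ioo (0 : ℝ) 1)))
    (hg' : ∀ᵐ t ∂volume.restrict (Ioo (0 : ℝ) 1), g t ∈ stdSimplex ℝ X) (φ : contDiffCurves X) :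
    ∀ᵐ t ∂volume.restrict (Ioo (0 : ℝ) 1), (weightedGrad hc Q hg hg' φ t).ofLp
      = fun e : X × X => √(edgeWeight Λ Q (g t) e.1 e.2 / 2) * grad (φ.1 t) e.1 e.2 :=
  (memLp_weightedGrad hc Q (contDiff_coe φ).continuous hg hg').coeFn_toLp.mono fun t ht => by
    have : weightedGrad hc Q hg hg' φ t = _ := ht
    rw [this]

lemma L2_norm_sq {α E : Type*} [MeasurableSpace α] {ν : Measure α} [NormedAddCommGroup E]
    [InnerProductSpace ℝ E] (f : Lp E 2 ν) : ‖f‖ ^ 2 = ∫ t, ‖f t‖ ^ 2 ∂ν := by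
  rw [← real_inner_self_eq_norm_sq, L2.inner_def]
  simp

lemma lagrangian_eq (hΛ : IsAdmissibleMean Λ) (hc : Continuous fun p : ℝ × ℝ => Λ p.1 p.2)
    (hQ : ∀ x y, 0 ≤ Q x y) (μ₀ μ₁ : X → ℝ)
    {g : ℝ → X → ℝ} (hg : AEStronglyMeasurable g (volume.restrict (Ioo (0 : ℝ) 1)))
    (hg' : ∀ᵐ t ∂volume.restrict (Ioo (0 : ℝ) 1), g t ∈ stdSimplex ℝ X) (φ : contDiffCurves X) :
    lagrangian Λ Q μ₀ μ₁ g φ.1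
      = lagrangianLinear μ₀ μ₁ hg hg' φ - (1 / 2) * ‖weightedGrad hc Q hg hg' φ‖ ^ 2 := by
  have i1 := integrable_ip_deriv φ.2 hg hg'
  have i2 := integrable_ham hc Q φ.2 hg hg'
  have h : (1 / 2) * ‖weightedGrad hc Q hg hg' φ‖ ^ 2
      = ∫ t in Ioo (0 : ℝ) 1, (ham Λ Q (deriv φ.1 t) (φ.1 t) (g t) - ip (deriv φ.1 t) (g t)) := by
    rw [L2_norm_sq, ← integral_const_mul]
    refine integral_congr_ae ?_
    filter_upwards [coeFn_weightedGrad hc Q hg hg' φ, hg'] with t h1 h2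
    rw [EuclideanSpace.norm_sq_eq, h1]
    simp only [ham, normSq, add_sub_cancel_left]
    rw [Fintype.sum_prod_type, Finset.mul_sum (a := (1 / 2 : ℝ))]
    simp only [Finset.mul_sum]
    refine Finset.sum_congr rfl fun x _ => Finset.sum_congr rfl fun y _ => ?_
    have hw := edgeWeight_nonneg hΛ hQ h2.1 x y
    rw [Real.norm_eq_abs, sq_abs, mul_pow, Real.sq_sqrt (by positivity)]
    ring
  rw [h, integral_sub i2 i1]
  simp only [lagrangian, lagrangianLinear, LinearMap.coe_mk, AddHom.coe_mk]
  ring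

end

/-! ### From the weak equation to a continuous curve and its flux. -/

lemma intervalIntegrable_of_integrableOn_Ioo {T : ℝ} (hT : 0 ≤ T) {v : ℝ → ℝ}
    (hv : IntegrableOn v (Ioo 0 T)) : IntervalIntegrable v volume 0 T := by
  rw [intervalIntegrable_iff, uIoc_of_le hT, integrableOn_Ioc_iff_integrableOn_Ioo]
  exact hv

/-- If `g` satisfies the weak form of `g' = v` with boundary values `a` and `b` on `(0,1)`, then it
agrees almost everywhere with the primitive of `v` that starts at `a`, and this ends at `b`. -/
lemma eq_primitive_of_weak_boundary {g v : ℝ → ℝ} {a b : ℝ}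
    (hg : IntegrableOn g (Ioo 0 1)) (hv : IntegrableOn v (Ioo 0 1))
    (h : ∀ η : ℝ → ℝ, ContDiff ℝ 1 η →
      η 1 * b - η 0 * a = ∫ t in Ioo (0 : ℝ) 1, (deriv η t * g t + η t * v t)) :
    a + ∫ s in (0 : ℝ)..1, v s = b ∧
      ∀ᵐ t ∂volume.restrict (Ioo (0 : ℝ) 1), a + ∫ s in (0 : ℝ)..t, v s = g t := by
  have hv' := intervalIntegrable_of_integrableOn_Ioo zero_le_one hv
  have hend : a + ∫ s in (0 : ℝ)..1, v s = b := by
    have := h (fun _ => 1) contDiff_const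
    simp only [one_mul, deriv_const', zero_mul, zero_add] at this
    rw [setIntegral_Ioo_eq_intervalIntegral zero_le_one] at this
    linarith
  refine ⟨hend, ?_⟩
  have hcont : ContinuousOn (fun t => a + ∫ s in (0 : ℝ)..t, v s) (Icc 0 1) := by
    have := (absolutelyContinuousOnInterval_primitive hv' a).continuousOn
    rwa [uIcc_of_le zero_le_one] at this
  have hpi : IntegrableOn (fun t => a + ∫ s in (0 : ℝ)..t, v s) (Ioo 0 1) :=
    hcont.integrableOn_Icc.mono_set Ioo_subset_Icc_self
  have hbd : ∀ {f η : ℝ → ℝ}, IntegrableOn f (Ioo 0 1) → Continuous η →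
      IntegrableOn (fun t => f t * η t) (Ioo 0 1) := fun {f η} hf hη => by
    have := (intervalIntegrable_of_integrableOn_Ioo zero_le_one hf).mul_continuousOn
      hη.continuousOn
    rwa [intervalIntegrable_iff, uIoc_of_le zero_le_one,
      integrableOn_Ioc_iff_integrableOn_Ioo] at this
  have key := isOpen_Ioo.ae_eq_zero_of_integral_contDiff_smul_eq_zero
    (hpi.sub hg).locallyIntegrableOn (μ := volume) (U := Ioo (0 : ℝ) 1) (by
      intro r hr hrc hrs
      -- The test function is the primitive of `r`. It need not vanish at time 1, which is why the
      -- weak form has to carry the end values.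
      have hd : ∀ t, HasDerivAt (fun t => ∫ s in (0 : ℝ)..t, r s) (r t) t := fun t =>
        intervalIntegral.integral_hasDerivAt_right (hr.continuous.intervalIntegrable _ _)
          hr.continuous.aestronglyMeasurable.stronglyMeasurableAtFilter hr.continuous.continuousAt
      have hderiv : deriv (fun t => ∫ s in (0 : ℝ)..t, r s) = r := funext fun t => (hd t).deriv
      have hη : ContDiff ℝ 1 (fun t => ∫ s in (0 : ℝ)..t, r s) := by
        rw [contDiff_one_iff_deriv, hderiv]
        exact ⟨fun t => (hd t).differentiableAt, hr.continuous⟩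
      have e1 := intervalIntegral_mul_deriv_test one_pos a hv' hη
      have e2 := h _ hη
      rw [hderiv] at e1 e2
      set η : ℝ → ℝ := fun t => ∫ s in (0 : ℝ)..t, r s with hηdef
      have i1 : IntegrableOn (fun t => r t * g t) (Ioo 0 1) := by
        simpa only [mul_comm] using hbd hg hr.continuous
      have i2 : IntegrableOn (fun t => η t * v t) (Ioo 0 1) := by
        simpa only [mul_comm] using hbd hv hη.continuous
      rw [integral_add i1 i2] at e2
      have e3 : ∫ t in Ioo (0 : ℝ) 1, v t * η t = ∫ t in Ioo (0 : ℝ) 1, η t * v t := by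
        simp only [mul_comm]
      rw [hend, e3] at e1
      have e4 : ∫ t, r t • ((fun t => a + ∫ s in (0 : ℝ)..t, v s) - g) t
          = ∫ t in Ioo (0 : ℝ) 1, ((a + ∫ s in (0 : ℝ)..t, v s) * r t - r t * g t) := by
        rw [← setIntegral_eq_integral_of_forall_compl_eq_zero (s := Ioo (0 : ℝ) 1) fun t ht => by
          rw [test_eq_zero_of_notMem hrs ht, zero_smul]]
        exact integral_congr_ae (.of_forall fun t => by simp; ring)
      rw [e4, integral_sub (hbd hpi hr.continuous) i1, e1]
      linarith)
  rw [ae_restrict_iff' measurableSet_Ioo]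
  exact key.mono fun t ht htm => sub_eq_zero.1 (ht htm)

section

variable {X : Type*} [Fintype X] {Λ : ℝ → ℝ → ℝ} {Q : X → X → ℝ}

lemma integrable_divergence {V : ℝ → X → X → ℝ} {s : Set ℝ}
    (hV : ∀ x y, IntegrableOn (fun t => V t x y) s) (x : X) :
    IntegrableOn (fun t => -divergence (V t) x) s :=
  (Integrable.const_mul (integrable_finsetSum _ fun y _ => (hV x y).sub (hV y x)) _).neg

/-- A weak solution of the continuity equation has a continuous representative. -/
lemma exists_isCE_of_weak {μ₀ μ₁ : X → ℝ} {g : ℝ → X → ℝ} {V : ℝ → X → X → ℝ}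
    (hg : ∀ x, IntegrableOn (fun t => g t x) (Ioo 0 1))
    (hg' : ∀ᵐ t ∂volume.restrict (Ioo (0 : ℝ) 1), g t ∈ stdSimplex ℝ X)
    (hV : ∀ x y, IntegrableOn (fun t => V t x y) (Ioo 0 1))
    (h : ∀ x, ∀ η : ℝ → ℝ, ContDiff ℝ 1 η → η 1 * μ₁ x - η 0 * μ₀ x
      = ∫ t in Ioo (0 : ℝ) 1, (deriv η t * g t x + η t * -divergence (V t) x)) :
    ∃ μ : ℝ → X → ℝ, IsCE 1 μ₀ μ₁ μ V ∧
      ∀ᵐ t ∂volume.restrict (Ioo (0 : ℝ) 1), μ t = g t := by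
  have hdiv := integrable_divergence hV
  have hdiv' := fun x => intervalIntegrable_of_integrableOn_Ioo zero_le_one (hdiv x)
  have hw := fun x => eq_primitive_of_weak_boundary (hg x) (hdiv x) (h x)
  set μ : ℝ → X → ℝ := fun t x => μ₀ x + ∫ s in (0 : ℝ)..t, -divergence (V s) x with hμ
  have hae : ∀ᵐ t ∂volume.restrict (Ioo (0 : ℝ) 1), μ t = g t :=
    (ae_all_iff.2 fun x => (hw x).2).mono fun t ht => funext ht
  have hcx : ∀ x, ContinuousOn (fun t => μ t x) (Icc 0 1) := fun x => by
    have := (absolutelyContinuousOnInterval_primitive (hdiv' x) (μ₀ x)).continuousOn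
    rwa [uIcc_of_le zero_le_one] at this
  have hae' : ∀ᵐ t ∂volume.restrict (Icc (0 : ℝ) 1), μ t ∈ stdSimplex ℝ X := by
    rw [Measure.restrict_congr_set Ioo_ae_eq_Icc.symm]
    filter_upwards [hae, hg'] with t h1 h2
    rwa [h1]
  refine ⟨μ, ⟨continuousOn_pi.2 hcx, ?_, fun t ht => ⟨fun x => ?_, ?_⟩, fun x => ?_, ?_, ?_⟩, hae⟩
  · have : IntegrableOn V (Icc 0 1) := by
      rw [integrableOn_Icc_iff_integrableOn_Ioo]
      exact Integrable.of_eval fun x => Integrable.of_eval fun y => hV x y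
    exact this.locallyIntegrableOn
  -- Nonnegativity passes from almost every time to all times as equality of the continuous
  -- functions `μ t x` and `|μ t x|`.
  · have := Measure.eqOn_Icc_of_ae_eq volume zero_ne_one
      (f := fun t => μ t x) (g := fun t => |μ t x|)
      (hae'.mono fun t ht => (abs_of_nonneg (ht.1 x)).symm) (hcx x) (hcx x).abs ht
    simp only at this
    rw [this]
    exact abs_nonneg _
  · exact Measure.eqOn_Icc_of_ae_eq volume zero_ne_one
      (f := fun t => ∑ x, μ t x) (g := fun _ => 1) (hae'.mono fun t ht => ht.2)
      (continuousOn_finsetSum _ fun x _ => hcx x) continuousOn_const ht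
  · exact hasWeakDeriv_primitive one_pos (μ₀ x) (hdiv' x)
  · funext x; simp [hμ]
  · exact funext fun x => (hw x).1

/-- A curve with bounded Lagrangian solves the continuity equation with a flux of finite action. -/
theorem exists_isCE_of_lagrangian_le (hΛ : IsAdmissibleMean Λ)
    (hc : Continuous fun p : ℝ × ℝ => Λ p.1 p.2) (hQ : ∀ x y, 0 ≤ Q x y) {μ₀ μ₁ : X → ℝ}
    {g : ℝ → X → ℝ} (hg : AEStronglyMeasurable g (volume.restrict (Ioo (0 : ℝ) 1)))
    (hg' : ∀ᵐ t ∂volume.restrict (Ioo (0 : ℝ) 1), g t ∈ stdSimplex ℝ X) {D : ℝ}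
    (hD : ∀ φ, ContDiff ℝ 1 φ → lagrangian Λ Q μ₀ μ₁ g φ ≤ D) :
    ∃ (μ : ℝ → X → ℝ) (Ψ V : ℝ → X → X → ℝ), IsCE 1 μ₀ μ₁ μ V ∧
      (∀ᵐ t ∂volume.restrict (Ioo (0 : ℝ) 1),
        ∀ x y, V t x y = √(2 * edgeWeight Λ Q (μ t) x y) * Ψ t x y) ∧
      Integrable (fun t => ∑ x, ∑ y, Ψ t x y ^ 2) (volume.restrict (Ioo (0 : ℝ) 1)) ∧
      ∫ t in Ioo (0 : ℝ) 1, ∑ x, ∑ y, Ψ t x y ^ 2 ≤ 2 * D := by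
  classical
  obtain ⟨ψ, hψD, hψ⟩ := exists_inner_eq_of_sub_half_norm_sq_le (lagrangianLinear μ₀ μ₁ hg hg')
    (weightedGrad hc Q hg hg') (D := D) fun φ => by
      rw [← lagrangian_eq hΛ hc hQ]
      exact hD _ φ.2
  set Ψ : ℝ → X → X → ℝ := fun t x y => (ψ t).ofLp (x, y) with hΨ
  -- The representing vector is paired with √(ĝ/2) ∇φ. Matching this with ½ V ∇φ from discrete
  -- integration by parts forces V = √(2ĝ) Ψ.
  set V : ℝ → X → X → ℝ := fun t x y => √(2 * edgeWeight Λ Q (g t) x y) * Ψ t x y with hVdef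
  have hgi : ∀ x, IntegrableOn (fun t => g t x) (Ioo 0 1) := fun x =>
    memLp_one_iff_integrable.1 (memLp_comp_curve (F := fun z : ℝ × (X → ℝ) => z.2 x)
      (by fun_prop) hg hg' 1)
  have hΨL : ∀ x y, MemLp (fun t => Ψ t x y) 2 (volume.restrict (Ioo (0 : ℝ) 1)) := fun x y =>
    (Lp.memLp ψ).eval_piLp (x, y)
  have hVi : ∀ x y, IntegrableOn (fun t => V t x y) (Ioo 0 1) := fun x y => by
    have h1 := continuous_edgeWeight hc Q x y
    have hF : Continuous fun z : ℝ × (X → ℝ) => √(2 * edgeWeight Λ Q z.2 x y) := by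
      have h' : Continuous fun z : ℝ × (X → ℝ) => edgeWeight Λ Q z.2 x y := h1.comp continuous_snd
      fun_prop
    exact (memLp_comp_curve hF hg hg' 2).integrable_mul (hΨL x y)
  have hweak : ∀ x, ∀ η : ℝ → ℝ, ContDiff ℝ 1 η → η 1 * μ₁ x - η 0 * μ₀ x
      = ∫ t in Ioo (0 : ℝ) 1, (deriv η t * g t x + η t * -divergence (V t) x) := by
    intro x η hη
    set e : X → ℝ := Pi.single x 1 with he
    have hφ : ContDiff ℝ 1 fun t => η t • e := hη.smul contDiff_const
    have hipe : ∀ (c : ℝ) (μ : X → ℝ), ip (c • e) μ = c * μ x := fun c μ => by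
      rw [ip_smul_left]
      simp [ip, he, Pi.single_apply]
    have hd : ∀ t, deriv (fun t => η t • e) t = deriv η t • e := fun t =>
      ((hη.differentiable one_ne_zero t).hasDerivAt.smul_const e).deriv
    have h1 := hψ ⟨_, hφ⟩
    simp only [lagrangianLinear, LinearMap.coe_mk, AddHom.coe_mk, hd, hipe] at h1
    rw [L2.inner_def] at h1
    have h2 : ∫ t in Ioo (0 : ℝ) 1, inner ℝ (ψ t) (weightedGrad hc Q hg hg' ⟨_, hφ⟩ t)
        = ∫ t in Ioo (0 : ℝ) 1, η t * -divergence (V t) x := by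
      refine integral_congr_ae ?_
      filter_upwards [coeFn_weightedGrad hc Q hg hg' ⟨_, hφ⟩, hg'] with t h3 h4
      have h5 := ip_divergence (η t • e) (V t)
      rw [hipe] at h5
      rw [h5, PiLp.inner_apply, h3, Fintype.sum_prod_type, Finset.mul_sum]
      refine Finset.sum_congr rfl fun a _ => ?_
      rw [Finset.mul_sum]
      refine Finset.sum_congr rfl fun b _ => ?_
      have hw := edgeWeight_nonneg hΛ hQ h4.1 a b
      have hs : √(2 * edgeWeight Λ Q (g t) a b) = 2 * √(edgeWeight Λ Q (g t) a b / 2) := by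
        rw [show 2 * edgeWeight Λ Q (g t) a b = 2 ^ 2 * (edgeWeight Λ Q (g t) a b / 2) by ring,
          Real.sqrt_mul (by positivity), Real.sqrt_sq (by norm_num)]
      simp only [hVdef, hΨ, hs, RCLike.inner_apply, conj_trivial]
      ring
    rw [h2] at h1
    have i1 : IntegrableOn (fun t => deriv η t * g t x) (Ioo 0 1) := by
      have hd1 := hη.continuous_deriv le_rfl
      exact memLp_one_iff_integrable.1 (memLp_comp_curve
        (F := fun z : ℝ × (X → ℝ) => deriv η z.1 * z.2 x) (by fun_prop) hg hg' 1)
    have i2 : IntegrableOn (fun t => η t * -divergence (V t) x) (Ioo 0 1) := by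
      have := (intervalIntegrable_of_integrableOn_Ioo zero_le_one
        (integrable_divergence hVi x)).continuousOn_mul hη.continuous.continuousOn
      rwa [intervalIntegrable_iff, uIoc_of_le zero_le_one,
        integrableOn_Ioc_iff_integrableOn_Ioo] at this
    rw [integral_add i1 i2]
    linarith
  obtain ⟨μ, hμ1, hμ2⟩ := exists_isCE_of_weak hgi hg' hVi hweak
  refine ⟨μ, Ψ, V, hμ1, hμ2.mono fun t ht x y => by rw [ht], ?_, ?_⟩
  · exact integrable_finsetSum _ fun x _ => integrable_finsetSum _ fun y _ =>
      (hΨL x y).integrable_sq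
  · refine le_trans (le_of_eq ?_) hψD
    rw [L2_norm_sq]
    refine integral_congr_ae (.of_forall fun t => ?_)
    simp only [EuclideanSpace.norm_sq_eq, Fintype.sum_prod_type, Real.norm_eq_abs, sq_abs, hΨ]

end

/-! ### Moving curves into the interior of the simplex. -/

/-- The weighted inequality `(b v + u)² ≤ (p + q) (b w + s)` for `v² ≤ p w` and `u² ≤ q s`. -/
lemma sq_add_le_of_sq_le {b v u p q w s : ℝ} (hb0 : 0 ≤ b) (hb1 : b ≤ 1) (hw : 0 ≤ w)
    (hp : 0 ≤ p) (hq : 0 ≤ q) (hs : 0 ≤ s) (hv : v ^ 2 = p * w) (hu : u ^ 2 ≤ q * s) :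
    (b * v + u) ^ 2 ≤ (p + q) * (b * w + s) := by
  have hpw := mul_nonneg hp hw
  have h1 : (b * v) ^ 2 ≤ (b * p) * (b * w) := by rw [mul_pow, hv]; nlinarith
  have h2 : v * u ≤ (q * w + p * s) / 2 := by
    refine (le_abs_self _).trans (abs_le_of_sq_le_sq ?_ (by positivity))
    have h3 : (v * u) ^ 2 ≤ p * w * (q * s) := by
      rw [mul_pow, hv]
      exact mul_le_mul_of_nonneg_left hu hpw
    nlinarith [sq_nonneg (q * w - p * s)]
  nlinarith [mul_le_mul_of_nonneg_left h2 hb0, mul_nonneg (sub_nonneg.2 hb1) (mul_nonneg hp hs),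
    mul_nonneg (mul_nonneg hb0 (sub_nonneg.2 hb1)) hpw]

section

variable {X : Type*} [Fintype X] {Λ : ℝ → ℝ → ℝ} {Q : X → X → ℝ} {π : X → ℝ}

/-- Moving a solution of the continuity equation towards `π` by a time dependent amount that
vanishes at the end points. -/
lemma IsCE.perturb {μ₀ μ₁ : X → ℝ} {μ : ℝ → X → ℝ} {V : ℝ → X → X → ℝ} (h : IsCE 1 μ₀ μ₁ μ V)
    (hπ : π ∈ stdSimplex ℝ X) {G : X → X → X → ℝ}
    (hG : ∀ ν : X → ℝ, ∀ x, divergence (∑ z, ν z • G z) x = ν x - (∑ z, ν z) * π x)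
    {a : ℝ → ℝ} (ha : ContDiff ℝ ∞ a) (ha0 : a 0 = 0) (ha1 : a 1 = 0)
    (haI : ∀ t ∈ Icc (0 : ℝ) 1, a t ∈ Icc (0 : ℝ) 1) :
    IsCE 1 μ₀ μ₁ (fun t => (1 - a t) • μ t + a t • π)
      (fun t => (1 - a t) • V t + deriv a t • ∑ z, μ t z • G z) := by
  have hac : Continuous a := ha.continuous
  have had : Continuous (deriv a) := ha.continuous_deriv (by simp)
  have hV : IntegrableOn V (Icc 0 1) := h.locallyIntegrableOn.integrableOn_isCompact isCompact_Icc
  have hmx : ∀ x, ContinuousOn (fun t => μ t x) (Icc 0 1) := fun x =>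
    (continuous_apply x).comp_continuousOn h.continuousOn
  refine ⟨?_, ?_, fun t ht => ?_, fun x => ?_, ?_, ?_⟩
  · exact ((continuousOn_const.sub hac.continuousOn).smul h.continuousOn).add
      (hac.continuousOn.smul continuousOn_const)
  · refine IntegrableOn.locallyIntegrableOn (IntegrableOn.add ?_ ?_)
    · exact hV.continuousOn_smul (continuousOn_const.sub hac.continuousOn) isCompact_Icc
    · refine ContinuousOn.integrableOn_compact isCompact_Icc (had.continuousOn.smul ?_)
      exact continuousOn_finsetSum _ fun z _ => (hmx z).smul continuousOn_const
  · obtain ⟨h1, h2⟩ := haI t ht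
    exact convex_stdSimplex ℝ X (h.prob t ht) hπ (by linarith) h1 (by ring)
  -- The original equation is tested with (1 - a) η. The terms in `deriv a`, from this test function
  -- and from a • π, are balanced by the divergence a' (μ - π) of the correction flux.
  · intro η hη1 hη2 hη3
    have hb : ContDiff ℝ ∞ fun t => (1 - a t) * η t := (contDiff_const.sub ha).mul hη1
    have hηc := hη1.continuous
    have hηd : Continuous (deriv η) := hη1.continuous_deriv (by simp)
    have e1 := h.continuity_equation x (fun t => (1 - a t) * η t) hb (hη2.mul_left)
      ((tsupport_mul_subset_right (f := fun t => 1 - a t) (g := η)).trans hη3)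
    have hdb : ∀ t, deriv (fun t => (1 - a t) * η t) t
        = (1 - a t) * deriv η t - deriv a t * η t := fun t => by
      have d1 := ((ha.differentiable (by simp) t).hasDerivAt.const_sub 1).mul
        (hη1.differentiable (by simp) t).hasDerivAt
      rw [show deriv (fun t => (1 - a t) * η t) t = _ from d1.deriv]
      ring
    have hw : HasWeakDeriv 1 a (deriv a) := by
      have := (isH1_of_contDiff (φ := fun t (_ : Unit) => a t)
        (contDiff_pi.2 fun _ => ha.of_le (by simp))).weakDeriv ()
      have hd : ∀ t, deriv (fun t (_ : Unit) => a t) t () = deriv a t := fun t => by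
        rw [deriv_pi fun _ => ha.differentiable (by simp) t]
      simpa only [hd] using this
    have e2 := hw η hη1 hη2 hη3
    have hdivV : IntegrableOn (fun t => -divergence (V t) x) (Ioo 0 1) :=
      integrable_divergence (fun x y => ((hV.mono_set Ioo_subset_Icc_self).eval x).eval y) x
    have hci : ∀ {f : ℝ → ℝ}, ContinuousOn f (Icc 0 1) → IntegrableOn f (Ioo 0 1) := fun hf =>
      hf.integrableOn_Icc.mono_set Ioo_subset_Icc_self
    have i0 : IntegrableOn (fun t => -divergence (V t) x * ((1 - a t) * η t)) (Ioo 0 1) := by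
      have := (intervalIntegrable_of_integrableOn_Ioo zero_le_one hdivV).mul_continuousOn
        hb.continuous.continuousOn
      rwa [intervalIntegrable_iff, uIoc_of_le zero_le_one,
        integrableOn_Ioc_iff_integrableOn_Ioo] at this
    have i1 : IntegrableOn (fun t => μ t x * deriv (fun t => (1 - a t) * η t) t) (Ioo 0 1) :=
      hci ((hmx x).mul (hb.continuous_deriv (by simp)).continuousOn)
    have i2 : IntegrableOn (fun t => π x * (a t * deriv η t)) (Ioo 0 1) :=
      hci (by fun_prop)
    have i3 : IntegrableOn (fun t => μ t x * (deriv a t * η t)) (Ioo 0 1) :=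
      hci ((hmx x).mul (by fun_prop))
    have i4 : IntegrableOn (fun t => π x * (deriv a t * η t)) (Ioo 0 1) :=
      hci (by fun_prop)
    have l1 : ∫ t in Ioo (0 : ℝ) 1, ((1 - a t) • μ t + a t • π) x * deriv η t
        = (∫ t in Ioo (0 : ℝ) 1, μ t x * deriv (fun t => (1 - a t) * η t) t)
          + (∫ t in Ioo (0 : ℝ) 1, π x * (a t * deriv η t))
          + ∫ t in Ioo (0 : ℝ) 1, μ t x * (deriv a t * η t) := by
      have i12 : IntegrableOn (fun t => μ t x * deriv (fun t => (1 - a t) * η t) t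
        + π x * (a t * deriv η t)) (Ioo 0 1) := i1.add i2
      rw [← integral_add i1 i2, ← integral_add i12 i3]
      refine integral_congr_ae (.of_forall fun t => ?_)
      simp only [hdb, Pi.add_apply, Pi.smul_apply, smul_eq_mul]
      ring
    have l2 : ∫ t in Ioo (0 : ℝ) 1,
          -divergence ((1 - a t) • V t + deriv a t • ∑ z, μ t z • G z) x * η t
        = (∫ t in Ioo (0 : ℝ) 1, -divergence (V t) x * ((1 - a t) * η t))
          + (∫ t in Ioo (0 : ℝ) 1, π x * (deriv a t * η t))
          - ∫ t in Ioo (0 : ℝ) 1, μ t x * (deriv a t * η t) := by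
      have i04 : IntegrableOn (fun t => -divergence (V t) x * ((1 - a t) * η t)
        + π x * (deriv a t * η t)) (Ioo 0 1) := i0.add i4
      rw [← integral_add i0 i4, ← integral_sub i04 i3]
      refine setIntegral_congr_fun measurableSet_Ioo fun t ht => ?_
      simp only [divergence_add, divergence_smul, hG,
        (h.prob t (Ioo_subset_Icc_self ht)).2]
      ring
    rw [l1, l2, e1, integral_const_mul, integral_const_mul, e2]
    ring
  · simp [ha0, h.initial]
  · simp [ha1, h.terminal]

/-- A bound for the action of a flux along the edges, at a positive probability vector. -/
lemma action_le (hΛ : IsAdmissibleMean Λ) (hQ : IsMarkovTriple Q π) {μ : X → ℝ}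
    (hμ : ∀ x, 0 < μ x) {V c : X → X → ℝ} (hV : ∀ x y, Q x y = 0 → V x y = 0)
    (hc : ∀ x y, 0 ≤ c x y)
    (h : ∀ x y, 0 < Q x y → V x y ^ 2 ≤ c x y * edgeWeight Λ Q μ x y) :
    action Λ Q μ V ≤ ENNReal.ofReal ((1 / 2) * ∑ x, ∑ y, c x y) := by
  have h2 : ENNReal.ofReal (1 / 2) = 1 / 2 := by
    rw [ENNReal.ofReal_div_of_pos two_pos]; simp
  rw [ENNReal.ofReal_mul (by norm_num), h2,
    ENNReal.ofReal_sum_of_nonneg fun x _ => Finset.sum_nonneg fun y _ => hc x y]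
  unfold action
  gcongr with x _
  rw [ENNReal.ofReal_sum_of_nonneg fun y _ => hc x y]
  gcongr with y _
  rcases (hQ.rate_nonneg x y).eq_or_lt with h0 | h0
  · rw [← h0, hQ.rate_eq_zero h0.symm, hV x y h0.symm]
    simp [actionDensity]
  · have h0' : 0 < Q y x := by
      refine (hQ.rate_nonneg y x).lt_of_ne fun h1 => ?_
      exact h0.ne' (hQ.rate_eq_zero h1.symm)
    have hs : 0 < μ x * Q x y := mul_pos (hμ x) h0
    have ht : 0 < μ y * Q y x := mul_pos (hμ y) h0'
    rw [actionDensity, if_pos ⟨hs, ht⟩]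
    refine ENNReal.ofReal_le_ofReal ?_
    rw [div_le_iff₀ (hΛ.pos hs ht)]
    exact h x y h0

/-- By detailed balance the two arguments of the mean coincide at π. -/
lemma IsMarkovTriple.edgeWeight_stationary (hΛ : IsAdmissibleMean Λ) (hQ : IsMarkovTriple Q π)
    {x y : X} (h : 0 < Q x y) : edgeWeight Λ Q π x y = π x * Q x y := by
  rw [edgeWeight, ← hQ.detailed_balance x y, hΛ.map_self (mul_pos (hQ.pi_pos x) h)]

lemma le_edgeWeight_perturb (hΛ : IsAdmissibleMean Λ) (hQ : IsMarkovTriple Q π) {μ : X → ℝ}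
    (hμ : μ ∈ stdSimplex ℝ X) {a : ℝ} (ha : a ∈ Icc (0 : ℝ) 1) {x y : X} (h : 0 < Q x y) :
    (1 - a) * edgeWeight Λ Q μ x y + a * (π x * Q x y)
      ≤ edgeWeight Λ Q ((1 - a) • μ + a • π) x y := by
  rw [← hQ.edgeWeight_stationary hΛ h]
  exact edgeWeight_add_le hΛ hQ.rate_nonneg hμ.1 (fun x => (hQ.pi_pos x).le)
    (by linarith [ha.2]) ha.1 x y

lemma perturb_pos (hQ : IsMarkovTriple Q π) {μ : X → ℝ} (hμ : μ ∈ stdSimplex ℝ X) {a : ℝ}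
    (ha0 : 0 < a) (ha1 : a ≤ 1) (x : X) : 0 < ((1 - a) • μ + a • π) x := by
  have h1 := mul_nonneg (sub_nonneg.2 ha1) (hμ.1 x)
  have h2 := mul_pos ha0 (hQ.pi_pos x)
  simp only [Pi.add_apply, Pi.smul_apply, smul_eq_mul]
  linarith

lemma sq_sum_flux_le (G : X → X → X → ℝ) {μ : X → ℝ} (hμ : μ ∈ stdSimplex ℝ X) (x y : X) :
    ((∑ z, μ z • G z) x y) ^ 2 ≤ (∑ z, |G z x y|) ^ 2 := by
  rw [← sq_abs]
  refine pow_le_pow_left₀ (abs_nonneg _) ?_ 2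
  simp only [Finset.sum_apply, Pi.smul_apply, smul_eq_mul]
  refine (Finset.abs_sum_le_sum_abs _ _).trans (Finset.sum_le_sum fun z _ => ?_)
  have h1 : μ z ≤ 1 := hμ.2 ▸ Finset.single_le_sum (fun y _ => hμ.1 y) (Finset.mem_univ z)
  rw [abs_mul, abs_of_nonneg (hμ.1 z)]
  nlinarith [abs_nonneg (G z x y)]

/-- The profile `δ t² (1 - t)²`. -/
def profile (δ t : ℝ) : ℝ := δ * (t ^ 2 * (1 - t) ^ 2)

lemma contDiff_profile (δ : ℝ) : ContDiff ℝ ∞ (profile δ) := by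
  unfold profile
  fun_prop

lemma deriv_profile (δ t : ℝ) : deriv (profile δ) t = 2 * δ * (t * (1 - t) * (1 - 2 * t)) := by
  have h := (((hasDerivAt_id t).pow 2).mul (((hasDerivAt_id t).const_sub 1).pow 2)).const_mul δ
  rw [show deriv (profile δ) t = _ from h.deriv]
  simp
  ring

lemma profile_mem_Icc {δ : ℝ} (h0 : 0 ≤ δ) (h1 : δ ≤ 1) {t : ℝ} (ht : t ∈ Icc (0 : ℝ) 1) :
    profile δ t ∈ Icc (0 : ℝ) 1 := by
  have hp : 0 ≤ t * (1 - t) := mul_nonneg ht.1 (by linarith [ht.2])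
  have hq : t * (1 - t) ≤ 1 := by nlinarith [ht.1, ht.2]
  have hs : (t * (1 - t)) ^ 2 ≤ 1 := pow_le_one₀ hp hq
  have e : profile δ t = δ * (t * (1 - t)) ^ 2 := by rw [profile, mul_pow]
  rw [e]
  exact ⟨by positivity, mul_le_one₀ h1 (sq_nonneg _) hs⟩

lemma profile_pos {δ : ℝ} (h0 : 0 < δ) {t : ℝ} (ht : t ∈ Ioo (0 : ℝ) 1) : 0 < profile δ t := by
  have h1 : 0 < t := ht.1
  have h2 : 0 < 1 - t := by linarith [ht.2]
  unfold profile
  positivity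

/-- The double zeros at the end points serve this estimate: with a the profile, a'² is at most of
order δ a, so the flux created by the mixing is controlled by the edge weight a π Q that the mixing
contributes. -/
lemma deriv_profile_sq_le (δ : ℝ) {t : ℝ} (ht : t ∈ Icc (0 : ℝ) 1) :
    deriv (profile δ) t ^ 2 ≤ 4 * δ * profile δ t := by
  rw [deriv_profile, profile]
  have h : (1 - 2 * t) ^ 2 ≤ 1 := by nlinarith [ht.1, ht.2]
  have h2 : 0 ≤ 4 * δ ^ 2 * (t ^ 2 * (1 - t) ^ 2) := by positivity
  nlinarith [mul_le_mul_of_nonneg_left h h2]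

lemma transportDist_sq_le {μ₀ μ₁ : X → ℝ} {μ : ℝ → X → ℝ} {V : ℝ → X → X → ℝ}
    (h : IsCE 1 μ₀ μ₁ μ V) {f : ℝ → ℝ} (hf : Integrable f (volume.restrict (Ioo (0 : ℝ) 1)))
    (hf0 : ∀ t, 0 ≤ f t) (hle : ∀ᵐ t ∂volume.restrict (Ioo (0 : ℝ) 1),
      action Λ Q (μ t) (V t) ≤ ENNReal.ofReal (f t)) :
    transportDist Λ Q μ₀ μ₁ ≠ ⊤ ∧
      (transportDist Λ Q μ₀ μ₁).toReal ^ 2 ≤ ∫ t in Ioo (0 : ℝ) 1, f t := by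
  have h1 : transportDist Λ Q μ₀ μ₁ ≤ ENNReal.ofReal (√(∫ t in Ioo (0 : ℝ) 1, f t)) := by
    refine (iInf₂_le_of_le μ V (iInf_le _ h)).trans ?_
    have h2 : ∫⁻ t in Icc (0 : ℝ) 1, action Λ Q (μ t) (V t)
        ≤ ENNReal.ofReal (∫ t in Ioo (0 : ℝ) 1, f t) := by
      rw [← Measure.restrict_congr_set Ioo_ae_eq_Icc,
        ofReal_integral_eq_lintegral_ofReal hf (.of_forall hf0)]
      exact lintegral_mono_ae hle
    refine (ENNReal.rpow_le_rpow h2 (by norm_num)).trans_eq ?_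
    rw [ENNReal.ofReal_rpow_of_nonneg (integral_nonneg hf0) (by norm_num), Real.sqrt_eq_rpow]
  refine ⟨ne_top_of_le_ne_top ENNReal.ofReal_ne_top h1, ?_⟩
  have h3 := ENNReal.toReal_le_of_le_ofReal (Real.sqrt_nonneg _) h1
  calc (transportDist Λ Q μ₀ μ₁).toReal ^ 2 ≤ √(∫ t in Ioo (0 : ℝ) 1, f t) ^ 2 :=
        pow_le_pow_left₀ ENNReal.toReal_nonneg h3 2
    _ = _ := Real.sq_sqrt (integral_nonneg hf0)

/-- The squared distance is controlled by any flux of the form `√(2 μ̂) Ψ` with `Ψ ∈ L²`. -/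
theorem transportDist_sq_le_of_isCE (hΛ : IsAdmissibleMean Λ) (hQ : IsMarkovTriple Q π)
    {μ₀ μ₁ : X → ℝ} {μ : ℝ → X → ℝ} {Ψ V : ℝ → X → X → ℝ} (h : IsCE 1 μ₀ μ₁ μ V)
    (hV : ∀ᵐ t ∂volume.restrict (Ioo (0 : ℝ) 1),
      ∀ x y, V t x y = √(2 * edgeWeight Λ Q (μ t) x y) * Ψ t x y)
    (hΨ : Integrable (fun t => ∑ x, ∑ y, Ψ t x y ^ 2) (volume.restrict (Ioo (0 : ℝ) 1))) :
    (transportDist Λ Q μ₀ μ₁).toReal ^ 2 ≤ ∫ t in Ioo (0 : ℝ) 1, ∑ x, ∑ y, Ψ t x y ^ 2 := by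
  obtain ⟨G, hG1, hG2⟩ := hQ.exists_flux
  -- Chosen so that `deriv_profile_sq_le` gives (a' U)² ≤ δ B · (a π Q) on every edge; where Q
  -- vanishes, division by zero makes `B` zero.
  set B : X → X → ℝ := fun x y => 4 * (∑ z, |G z x y|) ^ 2 / (π x * Q x y) with hB
  have hB0 : ∀ x y, 0 ≤ B x y := fun x y =>
    div_nonneg (by positivity) (mul_nonneg (hQ.pi_pos x).le (hQ.rate_nonneg x y))
  set C := (1 / 2) * ∑ x, ∑ y, B x y with hC
  have hC0 : 0 ≤ C := mul_nonneg (by norm_num)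
    (Finset.sum_nonneg fun x _ => Finset.sum_nonneg fun y _ => hB0 x y)
  have key : ∀ δ : ℝ, 0 < δ → δ ≤ 1 → (transportDist Λ Q μ₀ μ₁).toReal ^ 2
      ≤ (∫ t in Ioo (0 : ℝ) 1, ∑ x, ∑ y, Ψ t x y ^ 2) + δ * C := by
    intro δ hδ0 hδ1
    have hce := h.perturb hQ.prob hG2 (contDiff_profile δ) (by simp [profile])
      (by simp [profile]) fun t ht => profile_mem_Icc hδ0.le hδ1 ht
    have hint : ∫ t in Ioo (0 : ℝ) 1, (∑ x, ∑ y, Ψ t x y ^ 2 + δ * C)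
        = (∫ t in Ioo (0 : ℝ) 1, ∑ x, ∑ y, Ψ t x y ^ 2) + δ * C := by
      rw [integral_add hΨ (integrable_const _)]
      simp
    rw [← hint]
    refine (transportDist_sq_le hce (hΨ.add (integrable_const (δ * C))) (fun t => ?_) ?_).2
    · exact add_nonneg (Finset.sum_nonneg fun x _ => Finset.sum_nonneg fun y _ => sq_nonneg _)
        (mul_nonneg hδ0.le hC0)
    filter_upwards [hV, ae_restrict_mem measurableSet_Ioo] with t htV htI
    have htI' := Ioo_subset_Icc_self htI
    have hμt := h.prob t htI'
    have ha := profile_mem_Icc hδ0.le hδ1 htI'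
    have hap := profile_pos hδ0 htI
    have had := deriv_profile_sq_le δ htI'
    set a := profile δ t
    set a' := deriv (profile δ) t
    -- The 2 comes from V² = 2 w Ψ² and cancels the ½ in the action, leaving ∑ Ψ² + δ C.
    refine (action_le hΛ hQ (c := fun x y => 2 * Ψ t x y ^ 2 + δ * B x y)
      (fun x => perturb_pos hQ hμt hap ha.2 x) (fun x y hxy => ?_) (fun x y => ?_)
      fun x y hxy => ?_).trans_eq ?_
    · have e1 : V t x y = 0 := by
        rw [htV, edgeWeight, hxy, hQ.rate_eq_zero hxy]
        simp [hΛ.map_zero_zero]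
      simp [e1, Finset.sum_apply, hG1 _ x y hxy]
    · exact add_nonneg (by positivity) (mul_nonneg hδ0.le (hB0 x y))
    · have hw := edgeWeight_nonneg hΛ hQ.rate_nonneg hμt.1 x y
      have hle := le_edgeWeight_perturb hΛ hQ hμt ha hxy
      have hU := sq_sum_flux_le G hμt x y
      have hp : 0 < π x * Q x y := mul_pos (hQ.pi_pos x) hxy
      set w := edgeWeight Λ Q (μ t) x y
      set U := (∑ z, μ t z • G z) x y
      have e1 : ((1 - a) • V t + a' • ∑ z, μ t z • G z) x y
          = (1 - a) * (√(2 * w) * Ψ t x y) + a' * U := by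
        simp only [Pi.add_apply, Pi.smul_apply, smul_eq_mul, htV, U, w]
      rw [e1]
      set r := √(2 * w)
      have hr : r ^ 2 = 2 * w := Real.sq_sqrt (by positivity)
      have hBp : B x y * (π x * Q x y) = 4 * (∑ z, |G z x y|) ^ 2 := by
        rw [hB]; exact div_mul_cancel₀ _ hp.ne'
      refine le_trans ?_ (mul_le_mul_of_nonneg_left hle
        (add_nonneg (by positivity) (mul_nonneg hδ0.le (hB0 x y))))
      have hk : (a' * U) ^ 2 ≤ δ * B x y * (a * (π x * Q x y)) := by
        have : (a' * U) ^ 2 ≤ (4 * δ * a) * (∑ z, |G z x y|) ^ 2 := by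
          rw [mul_pow]
          exact mul_le_mul had hU (sq_nonneg _) (by positivity)
        nlinarith
      exact sq_add_le_of_sq_le (by linarith [ha.2]) (by linarith [ha.1]) hw (by positivity)
        (mul_nonneg hδ0.le (hB0 x y)) (mul_nonneg hap.le hp.le)
        (by rw [mul_pow, hr]; ring) hk
    · congr 1
      simp only [hC, Finset.sum_add_distrib, ← Finset.mul_sum, Pi.add_apply]
      ring
  refine le_of_forall_pos_le_add fun ε hε => ?_
  refine (key (min 1 (ε / (C + 1))) (lt_min one_pos (by positivity)) (min_le_left _ _)).trans ?_
  have : min 1 (ε / (C + 1)) * C ≤ ε := by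
    have h1 : min 1 (ε / (C + 1)) * C ≤ ε / (C + 1) * C :=
      mul_le_mul_of_nonneg_right (min_le_right _ _) hC0
    have h2 : ε / (C + 1) * (C + 1) = ε := div_mul_cancel₀ _ (by positivity)
    have h3 : 0 < ε / (C + 1) := by positivity
    nlinarith
  linarith

end

/-! ### Finiteness of the distance and the duality formula. -/

section

variable {X : Type*} [Fintype X] {Λ : ℝ → ℝ → ℝ} {Q : X → X → ℝ} {π : X → ℝ}

/-- The slowed down linear interpolation is driven by a constant flux. -/
lemma isCE_interpolation {μ₀ μ₁ : X → ℝ} (hμ₀ : μ₀ ∈ stdSimplex ℝ X)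
    (hμ₁ : μ₁ ∈ stdSimplex ℝ X) {F : X → X → ℝ} (hF : ∀ x, divergence F x = μ₀ x - μ₁ x) :
    IsCE 1 μ₀ μ₁ (fun t => (1 - (3 * t ^ 2 - 2 * t ^ 3)) • μ₀ + (3 * t ^ 2 - 2 * t ^ 3) • μ₁)
      (fun t => (6 * (t * (1 - t))) • F) := by
  have hc : ContDiff ℝ 1 fun t : ℝ =>
      (1 - (3 * t ^ 2 - 2 * t ^ 3)) • μ₀ + (3 * t ^ 2 - 2 * t ^ 3) • μ₁ := by fun_prop
  refine ⟨hc.continuous.continuousOn, ?_, fun t ht => ?_, fun x => ?_, ?_, ?_⟩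
  · have : Continuous fun t : ℝ => (6 * (t * (1 - t))) • F := by fun_prop
    exact this.locallyIntegrable.locallyIntegrableOn _
  · have h0 : 0 ≤ 3 * t ^ 2 - 2 * t ^ 3 := by
      nlinarith [mul_nonneg (sq_nonneg t) (sub_nonneg.2 ht.2), sq_nonneg t]
    have h1 : 0 ≤ 1 - (3 * t ^ 2 - 2 * t ^ 3) := by
      nlinarith [mul_nonneg (sq_nonneg (1 - t)) ht.1, sq_nonneg (1 - t)]
    exact convex_stdSimplex ℝ X hμ₀ hμ₁ h1 h0 (by ring)
  · have hd : ∀ t : ℝ, deriv (fun t : ℝ => (1 - (3 * t ^ 2 - 2 * t ^ 3)) • μ₀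
        + (3 * t ^ 2 - 2 * t ^ 3) • μ₁) t x = -divergence ((6 * (t * (1 - t))) • F) x := by
      intro t
      have hθ := (((hasDerivAt_id t).pow 2).const_mul 3).sub (((hasDerivAt_id t).pow 3).const_mul 2)
      have h := ((hθ.const_sub 1).smul_const μ₀).add (hθ.smul_const μ₁)
      rw [show deriv (fun t : ℝ => (1 - (3 * t ^ 2 - 2 * t ^ 3)) • μ₀
        + (3 * t ^ 2 - 2 * t ^ 3) • μ₁) t = _ from h.deriv, divergence_smul, hF]
      simp
      ring
    have := (isH1_of_contDiff hc).weakDeriv x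
    simpa only [hd] using this
  · simp
  · norm_num

/-- Interpolation may run along the boundary of the simplex, so it too is mixed with π. Its squared
speed (6 t (1 - t))² is 36 times the profile with δ = 1, so both fluxes are controlled by the weight
a π Q gained from π. -/
theorem transportDist_ne_top (hΛ : IsAdmissibleMean Λ) (hQ : IsMarkovTriple Q π) {μ₀ μ₁ : X → ℝ}
    (hμ₀ : μ₀ ∈ stdSimplex ℝ X) (hμ₁ : μ₁ ∈ stdSimplex ℝ X) : transportDist Λ Q μ₀ μ₁ ≠ ⊤ := by
  obtain ⟨G, hG1, hG2⟩ := hQ.exists_flux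
  set F : X → X → ℝ := ∑ z, (μ₀ z - μ₁ z) • G z with hF
  have hF0 : ∀ x y, Q x y = 0 → F x y = 0 := fun x y hxy => by
    simp [hF, Finset.sum_apply, hG1 _ x y hxy]
  have hFd : ∀ x, divergence F x = μ₀ x - μ₁ x := fun x => by
    rw [hF, hG2 (fun z => μ₀ z - μ₁ z), Finset.sum_sub_distrib, hμ₀.2, hμ₁.2]
    ring
  have hbase := isCE_interpolation hμ₀ hμ₁ hFd
  have hce := hbase.perturb hQ.prob hG2 (contDiff_profile 1) (by simp [profile])
    (by simp [profile]) fun t ht => profile_mem_Icc zero_le_one le_rfl ht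
  -- 72 = 2 · 36 and 8 = 2 · 4: the bounds for the two fluxes, doubled by (x + y)² ≤ 2 (x² + y²).
  set B : X → X → ℝ := fun x y =>
    (72 * F x y ^ 2 + 8 * (∑ z, |G z x y|) ^ 2) / (π x * Q x y) with hB
  have hB0 : ∀ x y, 0 ≤ B x y := fun x y =>
    div_nonneg (by positivity) (mul_nonneg (hQ.pi_pos x).le (hQ.rate_nonneg x y))
  refine (transportDist_sq_le hce (f := fun _ => (1 / 2) * ∑ x, ∑ y, B x y)
    (integrable_const _) (fun _ => mul_nonneg (by norm_num)
      (Finset.sum_nonneg fun x _ => Finset.sum_nonneg fun y _ => hB0 x y)) ?_).1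
  filter_upwards [ae_restrict_mem measurableSet_Ioo] with t htI
  have htI' := Ioo_subset_Icc_self htI
  have hμt := hbase.prob t htI'
  have ha := profile_mem_Icc zero_le_one le_rfl htI'
  have hap := profile_pos one_pos htI
  have had := deriv_profile_sq_le 1 htI'
  have hat : profile 1 t = (t * (1 - t)) ^ 2 := by rw [profile, mul_pow, one_mul]
  set μt := (1 - (3 * t ^ 2 - 2 * t ^ 3)) • μ₀ + (3 * t ^ 2 - 2 * t ^ 3) • μ₁
  set a := profile 1 t
  set a' := deriv (profile 1) t
  refine action_le hΛ hQ (fun x => perturb_pos hQ hμt hap ha.2 x) (fun x y hxy => ?_) hB0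
    fun x y hxy => ?_
  · simp [hF0 x y hxy, Finset.sum_apply, hG1 _ x y hxy]
  · have hw := edgeWeight_nonneg hΛ hQ.rate_nonneg hμt.1 x y
    have hle := le_edgeWeight_perturb hΛ hQ hμt ha hxy
    have hU := sq_sum_flux_le G hμt x y
    have hp : 0 < π x * Q x y := mul_pos (hQ.pi_pos x) hxy
    have hw' : 0 ≤ (1 - a) * edgeWeight Λ Q μt x y := mul_nonneg (by linarith [ha.2]) hw
    refine le_trans ?_ (mul_le_mul_of_nonneg_left
      (show a * (π x * Q x y) ≤ _ by linarith) (hB0 x y))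
    have hBp : B x y * (π x * Q x y) = 72 * F x y ^ 2 + 8 * (∑ z, |G z x y|) ^ 2 := by
      rw [hB]; exact div_mul_cancel₀ _ hp.ne'
    set U := (∑ z, μt z • G z) x y
    have e1 : ((1 - a) • (6 * (t * (1 - t))) • F + a' • ∑ z, μt z • G z) x y
        = (1 - a) * (6 * (t * (1 - t)) * F x y) + a' * U := by
      simp only [Pi.add_apply, Pi.smul_apply, smul_eq_mul, U]
    rw [e1, show B x y * (a * (π x * Q x y)) = a * (B x y * (π x * Q x y)) by ring, hBp]
    have k1 : (a' * U) ^ 2 ≤ (4 * a) * (∑ z, |G z x y|) ^ 2 := by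
      rw [mul_pow]
      exact mul_le_mul (by linarith) hU (sq_nonneg _) (by positivity)
    have k2 : ((1 - a) * (6 * (t * (1 - t)) * F x y)) ^ 2 ≤ 36 * a * F x y ^ 2 := by
      rw [hat, mul_pow]
      have h1 : (1 - (t * (1 - t)) ^ 2) ^ 2 ≤ 1 := by
        rw [← hat]
        exact pow_le_one₀ (by linarith [ha.2]) (by linarith [ha.1])
      calc (1 - (t * (1 - t)) ^ 2) ^ 2 * (6 * (t * (1 - t)) * F x y) ^ 2
          ≤ 1 * (6 * (t * (1 - t)) * F x y) ^ 2 := mul_le_mul_of_nonneg_right h1 (sq_nonneg _)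
        _ = 36 * (t * (1 - t)) ^ 2 * F x y ^ 2 := by ring
    have k3 := add_sq_le (a := (1 - a) * (6 * (t * (1 - t)) * F x y)) (b := a' * U)
    linarith

/-- Every dual value is at most half the squared distance. -/
lemma value_le_transportDist (hΛ : IsAdmissibleMean Λ) {μ₀ μ₁ : X → ℝ}
    (hfin : transportDist Λ Q μ₀ μ₁ ≠ ⊤) {φ : ℝ → X → ℝ} (hφ : φ ∈ HJ Λ Q 1) :
    ip (φ 1) μ₁ - ip (φ 0) μ₀ ≤ (1 / 2) * (transportDist Λ Q μ₀ μ₁).toReal ^ 2 := by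
  have h : ENNReal.ofReal (2 * (ip (φ 1) μ₁ - ip (φ 0) μ₀)) ^ (1 / 2 : ℝ)
      ≤ transportDist Λ Q μ₀ μ₁ :=
    le_iInf fun μ => le_iInf fun V => le_iInf fun hce =>
      ENNReal.rpow_le_rpow (HJ_value_le_action hΛ hφ hce) (by norm_num)
  rcases le_or_gt (ip (φ 1) μ₁ - ip (φ 0) μ₀) 0 with h0 | h0
  · exact h0.trans (by positivity)
  · rw [ENNReal.ofReal_rpow_of_nonneg (by linarith) (by norm_num), ← Real.sqrt_eq_rpow] at h
    have h1 := (ENNReal.ofReal_le_iff_le_toReal hfin).1 h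
    have h2 := (Real.sqrt_le_left ENNReal.toReal_nonneg).1 h1
    linarith

/-- Strong duality: the squared distance is at most twice any bound for the smooth dual values. -/
lemma transportDist_sq_le_of_forall_value_le (hΛ : IsAdmissibleMean Λ)
    (hc : Continuous fun p : ℝ × ℝ => Λ p.1 p.2) (hQ : IsMarkovTriple Q π) {μ₀ μ₁ : X → ℝ}
    (hμ₀ : μ₀ ∈ stdSimplex ℝ X) (hμ₁ : μ₁ ∈ stdSimplex ℝ X) {D : ℝ}
    (hD : ∀ φ ∈ HJC1 Λ Q 1, ip (φ 1) μ₁ - ip (φ 0) μ₀ ≤ D) :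
    (1 / 2) * (transportDist Λ Q μ₀ μ₁).toReal ^ 2 ≤ D := by
  obtain ⟨g, hg, hg', hgD⟩ := exists_curve_lagrangian_le hΛ hc hQ.rate_nonneg hμ₀ hμ₁ hD
  obtain ⟨μ, Ψ, V, hce, hV, hi, hle⟩ :=
    exists_isCE_of_lagrangian_le hΛ hc hQ.rate_nonneg hg hg' hgD
  have := transportDist_sq_le_of_isCE hΛ hQ hce hV hi
  linarith

end

end DiscreteTransport

end

theorem theorem3p2 {X : Type*} [Fintype X] (Q : X → X → ℝ) (π : X → ℝ) (Λ : ℝ → ℝ → ℝ)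
    (hQ : DiscreteTransport.IsMarkovTriple Q π) (hΛ : DiscreteTransport.IsAdmissibleMean Λ)
    (μ₀ μ₁ : X → ℝ) (hμ₀ : μ₀ ∈ stdSimplex ℝ X) (hμ₁ : μ₁ ∈ stdSimplex ℝ X) :
    DiscreteTransport.transportDist Λ Q μ₀ μ₁ ≠ ⊤ ∧
    IsLUB ((fun φ : ℝ → X → ℝ =>
          DiscreteTransport.ip (φ 1) μ₁ - DiscreteTransport.ip (φ 0) μ₀) ''
        DiscreteTransport.HJ Λ Q 1)
      ((1 / 2) * (DiscreteTransport.transportDist Λ Q μ₀ μ₁).toReal ^ 2) ∧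
    IsLUB ((fun φ : ℝ → X → ℝ =>
          DiscreteTransport.ip (φ 1) μ₁ - DiscreteTransport.ip (φ 0) μ₀) ''
        DiscreteTransport.HJC1 Λ Q 1)
      ((1 / 2) * (DiscreteTransport.transportDist Λ Q μ₀ μ₁).toReal ^ 2) := by
  open DiscreteTransport in
  have hfin := transportDist_ne_top hΛ hQ hμ₀ hμ₁
  have hlow : ∀ D, (∀ φ ∈ HJC1 Λ Q 1, ip (φ 1) μ₁ - ip (φ 0) μ₀ ≤ D) →
      (1 / 2) * (transportDist Λ Q μ₀ μ₁).toReal ^ 2 ≤ D := fun D hD => by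
    -- Distance and subsolutions see Λ only on the closed quadrant, so it may be replaced by an
    -- extension continuous on the whole plane, as the compactness and measurability arguments
    -- require.
    rw [← transportDist_clip]
    refine transportDist_sq_le_of_forall_value_le (isAdmissibleMean_clip hΛ) (continuous_clip hΛ)
      hQ hμ₀ hμ₁ fun φ hφ => hD φ ⟨?_, hφ.2⟩
    rw [← HJ_clip Λ hQ.rate_nonneg]
    exact hφ.1
  refine ⟨hfin, ⟨?_, fun D hD => hlow D fun φ hφ => ?_⟩, ⟨?_, fun D hD => hlow D fun φ hφ => ?_⟩⟩
  · rintro _ ⟨φ, hφ, rfl⟩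
    exact value_le_transportDist hΛ hfin hφ
  -- A bound over all subsolutions is in particular one over the C¹ subsolutions.
  · exact hD (mem_image_of_mem _ hφ.1)
  · rintro _ ⟨φ, hφ, rfl⟩
    exact value_le_transportDist hΛ hfin hφ.1
  · exact hD (mem_image_of_mem _ hφ)
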